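/- Let $\mathcal U$ be a monster model of the theory of (nontrivial) atomless Boolean algebras in the language $\{\cap,\cup,\le,{}^{c},0,1\}$, and let $M\prec\mathcal U$ be a small elementary submodel; precisely, it is enough that $\mathcal U$ is $\kappa$-saturated for some infinite cardinal $\kappa>|M|$. Let $G$ be the $\emptyset$-definable group with underlying set $x=x$ and operation the symmetric difference $x+y=(x\cap y^{c})\cup(y\cap x^{c})$. Let $S_G^{\mathrm{inv}}(\mathcal U,M)$ and $S_G^{\mathrm{fs}}(\mathcal U,M)$ be the sets of complete types $p(x)$ over $\mathcal U$ that are $M$-invariant, respectively finitely satisfiable in $M$. Each is a semigroup under the Newelski product: for every formula $\varphi(x,z)$ and every tuple $d$ from $\mathcal U$, $$\varphi(x,d)\in p*q\iff \varphi(x+b,d)\in p,\qquad\text{where } b\in\mathcal U,\ b\models q|_{Md}.$$ A left ideal of a semigroup $X$ is a nonempty $I\subseteq X$ with $XI\subseteq I$; it is minimal if it contains no other left ideal. An Ellis subgroup of $X$ is a set of the form $u*I$ with $I$ a minimal left ideal and $u\in I$ an idempotent, with the operation of $X$. A type $p\in S_G^{\mathrm{inv}}(\mathcal U,M)$ is left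 (right) dfg over $M$ if $p$ and all its left (right) translates by elements of $G(\mathcal U)$ are $M$-definable. Then: 1. $G$ is abelian. 2. The theory of atomless Boolean algebras has the independence property. 3. $G$ is dfg: there is a type $p\in S_G^{\mathrm{inv}}(\mathcal U,M)$ that is $\emptyset$-definable and both left and right dfg over $M$. 4. Ellis subgroups exist in both $S_G^{\mathrm{inv}}(\mathcal U,M)$ and $S_G^{\mathrm{fs}}(\mathcal U,M)$. Every Ellis subgroup of $S_G^{\mathrm{inv}}(\mathcal U,M)$ has exactly one element, and every Ellis subgroup of $S_G^{\mathrm{fs}}(\mathcal U,M)$ has at least two elements. Consequently no Ellis subgroup of $S_G^{\mathrm{inv}}(\mathcal U,M)$ is isomorphic to an Ellis subgroup of $S_G^{\mathrm{fs}}(\mathcal U,M)$. -/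

import Mathlib

universe u v w

namespace InvEllis

open FirstOrder FirstOrder.Language

/-! ### Types over a model -/

section Types

variable (L : FirstOrder.Language.{0, 0}) (U : Type u) [L.Structure U] [Nonempty U]

/-- The space `S_x(U)` of complete types over the whole structure `U`, in one variable `x`. -/
abbrev GlobalType : Type u := (L[[U]].completeTheory U).CompleteType Unit

/-- `U` is `κ`-saturated: every complete type in one variable over a set of fewer than `κ`
parameters is realized in `U`. -/
def IsSaturated (κ : Cardinal.{u}) : Prop :=
  ∀ A : Set U, Cardinal.mk A < κ →
    ∀ p : (L[[A]].completeTheory U).CompleteType Unit,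
      p ∈ (L[[A]].completeTheory U).realizedTypes U Unit

variable {L U}

set_option linter.unusedSectionVars false

/-- The elementary submodel `M` is small in `U`: for some infinite cardinal `κ > |M|` the
structure `U` is `κ`-saturated. -/
class IsSmall (M : L.ElementarySubstructure U) : Prop where
  exists_saturated : ∃ κ : Cardinal.{u}, Cardinal.aleph0 ≤ κ ∧ Cardinal.mk M < κ ∧
    IsSaturated L U κ

/-- The formula `φ(x, d)` over `U`, obtained from the `L`-formula `φ(z, x)` by replacing the
variables `z` by the parameters `d`. -/
def inst {α : Type*} (φ : L.Formula (α ⊕ Unit)) (d : α → U) : L[[U]].Formula Unit :=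
  BoundedFormula.constantsVarsEquiv.symm (φ.relabel (Sum.map d id) : L.Formula (U ⊕ Unit))

/-- `φ(x, d) ∈ p`. -/
def Mem {α : Type*} (p : GlobalType L U) (φ : L.Formula (α ⊕ Unit)) (d : α → U) : Prop :=
  Formula.equivSentence (inst φ d) ∈ p

/-- `b ⊨ p|_A`. -/
def Realizes (p : GlobalType L U) (A : Set U) (b : U) : Prop :=
  ∀ φ : L.Formula (A ⊕ Unit), Mem p φ (fun a => (a : U)) →
    φ.Realize (Sum.elim (fun a => (a : U)) (fun _ => b))

/-- `a ≡_A b`. -/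
def EquivOver (A : Set U) {α : Type*} (a b : α → U) : Prop :=
  ∀ ψ : L.Formula (A ⊕ α),
    ψ.Realize (Sum.elim (fun c => (c : U)) a) ↔ ψ.Realize (Sum.elim (fun c => (c : U)) b)

/-- `p` is invariant over `A`. -/
def IsInvariant (A : Set U) (p : GlobalType L U) : Prop :=
  ∀ (n : ℕ) (φ : L.Formula (Fin n ⊕ Unit)) (a b : Fin n → U),
    EquivOver (L := L) A a b → (Mem p φ a ↔ Mem p φ b)

/-- `p` is finitely satisfiable in `A`. -/
def IsFinSat (A : Set U) (p : GlobalType L U) : Prop :=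
  ∀ (n : ℕ) (φ : L.Formula (Fin n ⊕ Unit)) (d : Fin n → U), Mem p φ d →
    ∃ a ∈ A, φ.Realize (Sum.elim d (fun _ => a))

/-- `p` is `A`-definable: for every `L`-formula `φ(x, z)` the set of all `d` with `φ(x, d) ∈ p`
is definable over `A`. -/
def IsDefinable (A : Set U) (p : GlobalType L U) : Prop :=
  ∀ (n : ℕ) (φ : L.Formula (Fin n ⊕ Unit)), A.Definable L {d : Fin n → U | Mem p φ d}

variable (L U) in
/-- The theory of `U` has the independence property. -/
def HasIP : Prop :=
  ∃ (n m : ℕ) (φ : L.Formula (Fin n ⊕ Fin m)), ∀ k : ℕ,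
    ∃ (a : Fin k → Fin n → U) (b : Set (Fin k) → Fin m → U),
      ∀ (i : Fin k) (S : Set (Fin k)), φ.Realize (Sum.elim (a i) (b S)) ↔ i ∈ S

/-! Basic facts about membership in types. -/

theorem realize_inst {α : Type*} (φ : L.Formula (α ⊕ Unit)) (d : α → U) (b : U) :
    (inst φ d).Realize (fun _ => b) ↔ φ.Realize (Sum.elim d (fun _ => b)) := by
  have h := BoundedFormula.realize_constantsVarsEquiv (M := U) (φ := inst φ d)
    (v := fun _ : Unit => b) (xs := default)
  rw [Formula.Realize, ← h, inst, Equiv.apply_symm_apply, ← Formula.Realize,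
    Formula.realize_relabel]
  have : (Sum.elim (fun a : U => ((L.con a : L[[U]].Constants) : U)) (fun _ : Unit => b)) ∘
      Sum.map d id = Sum.elim d (fun _ => b) := by
    funext x; cases x <;> rfl
  rw [this]

theorem mem_of_imp_aux {L' : FirstOrder.Language.{v, w}} [L'.Structure U]
    (p : (L'.completeTheory U).CompleteType Unit) {φ ψ : L'.Formula Unit}
    (h : ∀ b : U, φ.Realize (fun _ => b) → ψ.Realize (fun _ => b))
    (hφ : Formula.equivSentence φ ∈ p) : Formula.equivSentence ψ ∈ p := by
  have key : L'.completeTheory U ⊨ᵇ φ.imp ψ := by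
    rw [Theory.models_formula_iff]
    intro N v
    have hU : (((φ.imp ψ).relabel Sum.inr : L'.Formula (Empty ⊕ Unit)).iAlls Unit :
        L'.Sentence) ∈ L'.completeTheory U := by
      rw [mem_completeTheory, Sentence.Realize, Formula.realize_iAlls]
      intro i
      rw [Formula.realize_relabel, Formula.realize_imp]
      exact h (i ())
    have hN := Theory.realize_sentence_of_mem (M := N) _ hU
    rw [Sentence.Realize, Formula.realize_iAlls] at hN
    have h2 := hN v
    rw [Formula.realize_relabel] at h2
    exact h2
  rw [Theory.models_formula_iff_onTheory_models_equivSentence] at key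
  have h3 := p.mem_of_models key
  have h4 := (p.isMaximal.mem_iff_models _).1 hφ
  have h5 := (p.isMaximal.mem_iff_models _).1 h3
  refine (p.isMaximal.mem_iff_models _).2 ?_
  rw [Theory.models_sentence_iff] at h4 h5 ⊢
  intro N
  have := h5 N
  have e : Formula.equivSentence (φ.imp ψ) =
    (Formula.equivSentence φ).imp (Formula.equivSentence ψ) := rfl
  rw [e, Sentence.Realize, Formula.realize_imp] at this
  exact this (h4 N)

/-- The complete type given by a set of formulas that is closed under conjunction, complete and
whose members are satisfiable in `U`. -/
def typeOfSet {L' : FirstOrder.Language.{v, w}} [L'.Structure U] (S : Set (L'.Formula Unit))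
    (hsat : ∀ φ ∈ S, ∃ b : U, φ.Realize (fun _ => b))
    (hinf : ∀ φ ∈ S, ∀ ψ ∈ S, φ ⊓ ψ ∈ S)
    (hcompl : ∀ φ, φ ∈ S ∨ φ.not ∈ S) : (L'.completeTheory U).CompleteType Unit where
  toTheory := {σ | Formula.equivSentence.symm σ ∈ S}
  subset' := by
    rintro _ ⟨σ, hσ, rfl⟩
    refine (hcompl _).resolve_right fun hn => ?_
    obtain ⟨b, hb⟩ := hsat _ hn
    let _ : (constantsOn Unit).Structure U := constantsOn.structure fun _ => b
    rw [Formula.realize_not, Formula.realize_equivSentence_symm] at hb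
    apply hb
    exact (LHom.realize_onSentence U (L'.lhomWithConstants Unit) σ).2 hσ
  isMaximal' := by
    have hnot : ∀ φ : L'.Formula Unit, φ ∈ S → φ.not ∉ S := by
      intro φ h1 h2
      obtain ⟨b, hb⟩ := hsat _ (hinf _ h1 _ h2)
      rw [Formula.realize_inf, Formula.realize_not] at hb
      exact hb.2 hb.1
    have hmono : ∀ φ ψ : L'.Formula Unit,
        (∀ b : U, φ.Realize (fun _ => b) → ψ.Realize (fun _ => b)) → φ ∈ S → ψ ∈ S := by
      intro φ ψ h hφ
      refine (hcompl ψ).resolve_right fun hn => ?_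
      obtain ⟨b, hb⟩ := hsat _ (hinf _ hφ _ hn)
      rw [Formula.realize_inf, Formula.realize_not] at hb
      exact hb.2 (h b hb.1)
    constructor
    · rw [Theory.isSatisfiable_iff_isFinitelySatisfiable]
      intro T0 hT0
      have : ∃ φ ∈ S, ∀ b : U, φ.Realize (fun _ => b) →
          ∀ σ ∈ T0, (Formula.equivSentence.symm σ).Realize (fun _ : Unit => b) := by
        classical
        induction T0 using Finset.induction_on with
        | empty => 
          rcases hcompl ⊤ with h | h
          · exact ⟨_, h, by simp⟩
          · exact ⟨_, h, by simp⟩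
        | insert σ T hσ ih =>
          rw [Finset.coe_insert, Set.insert_subset_iff] at hT0
          obtain ⟨φ, hφ, h⟩ := ih hT0.2
          refine ⟨_, hinf _ hφ _ hT0.1, fun b hb τ hτ => ?_⟩
          rw [Formula.realize_inf] at hb
          rcases Finset.mem_insert.1 hτ with rfl | hτ
          · exact hb.2
          · exact h b hb.1 τ hτ
      obtain ⟨φ, hφ, h⟩ := this
      obtain ⟨b, hb⟩ := hsat φ hφ
      let _ : (constantsOn Unit).Structure U := constantsOn.structure fun _ => b
      have : U ⊨ (T0 : L'[[Unit]].Theory) := by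
        refine ⟨fun σ hσ => ?_⟩
        exact (Formula.realize_equivSentence_symm U σ (fun _ => b)).1 (h b hb σ hσ)
      exact Theory.Model.isSatisfiable U
    · intro σ
      exact hcompl (Formula.equivSentence.symm σ)

theorem mem_typeOfSet {L' : FirstOrder.Language.{v, w}} [L'.Structure U]
    {S : Set (L'.Formula Unit)} {h1 h2 h3} {φ : L'.Formula Unit} :
    Formula.equivSentence φ ∈ typeOfSet (U := U) S h1 h2 h3 ↔ φ ∈ S := by
  change Formula.equivSentence.symm (Formula.equivSentence φ) ∈ S ↔ _
  rw [Equiv.symm_apply_apply]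

theorem Mem.imp {p : GlobalType L U} {α β : Type*} {φ : L.Formula (α ⊕ Unit)} {d : α → U}
    {ψ : L.Formula (β ⊕ Unit)} {e : β → U} (hp : Mem p φ d)
    (h : ∀ b : U, φ.Realize (Sum.elim d (fun _ => b)) → ψ.Realize (Sum.elim e (fun _ => b))) :
    Mem p ψ e :=
  mem_of_imp_aux p (fun b hb => (realize_inst ψ e b).2 (h b ((realize_inst φ d b).1 hb))) hp

theorem mem_congr {p : GlobalType L U} {α β : Type*} {φ : L.Formula (α ⊕ Unit)} {d : α → U}
    {ψ : L.Formula (β ⊕ Unit)} {e : β → U}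
    (h : ∀ b : U, φ.Realize (Sum.elim d (fun _ => b)) ↔ ψ.Realize (Sum.elim e (fun _ => b))) :
    Mem p φ d ↔ Mem p ψ e :=
  ⟨fun hp => hp.imp fun b => (h b).1, fun hp => hp.imp fun b => (h b).2⟩

theorem mem_not {p : GlobalType L U} {α : Type*} {φ : L.Formula (α ⊕ Unit)} {d : α → U} :
    Mem p φ.not d ↔ ¬ Mem p φ d := by
  have e : Formula.equivSentence (inst φ.not d) = (Formula.equivSentence (inst φ d)).not := rfl
  rw [Mem, e, p.not_mem_iff, Mem]

theorem mem_inf {p : GlobalType L U} {α : Type*} {φ ψ : L.Formula (α ⊕ Unit)} {d : α → U} :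
    Mem p (φ ⊓ ψ) d ↔ Mem p φ d ∧ Mem p ψ d := by
  refine ⟨fun h => ⟨h.imp fun b hb => ?_, h.imp fun b hb => ?_⟩, fun h => ?_⟩
  · rw [Formula.realize_inf] at hb; exact hb.1
  · rw [Formula.realize_inf] at hb; exact hb.2
  · by_contra hn
    rw [← mem_not] at hn
    have e : ∀ σ τ : L[[U]][[Unit]].Sentence, σ ∈ p → τ ∈ p → (σ ⊓ τ) ∈ p := by
      intro σ τ hσ hτ
      have := Theory.CompleteType.typesWith_inf (T := L[[U]].completeTheory U) σ τ
      exact (Set.ext_iff.1 this p).2 ⟨hσ, hτ⟩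
    exact (mem_not.1 hn) (e _ _ h.1 h.2)

theorem Mem.exists_realize {p : GlobalType L U} {α : Type*} {φ : L.Formula (α ⊕ Unit)}
    {d : α → U} (h : Mem p φ d) : ∃ b : U, φ.Realize (Sum.elim d (fun _ => b)) := by
  by_contra hn
  push Not at hn
  have : Mem p φ.not d := h.imp fun b hb => absurd hb (hn b)
  exact mem_not.1 this h

/-- Every formula with parameters uses only finitely many of them. -/
theorem exists_fin_vars {α : Type*} (φ : L.Formula (α ⊕ Unit)) :
    ∃ (n : ℕ) (e : Fin n → α) (ψ : L.Formula (Fin n ⊕ Unit)), ∀ (d : α → U) (v : Unit → U),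
      φ.Realize (Sum.elim d v) ↔ ψ.Realize (Sum.elim (d ∘ e) v) := by
  classical
  let A0 : Finset α := φ.freeVarFinset.toLeft
  let e := A0.equivFin
  refine ⟨A0.card, fun i => e.symm i, φ.restrictFreeVar fun x => Sum.casesOn x.1
    (fun x hx => Sum.inl (e ⟨x, by simpa [A0] using hx⟩)) (fun x _ => Sum.inr x) x.2,
    fun d v => ?_⟩
  refine (BoundedFormula.realize_restrictFreeVar (Sum.elim d v) ?_).symm
  rintro ⟨x | x, hx⟩ <;> simp

theorem exists_fin_params (φ : L.Formula (U ⊕ Unit)) :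
    ∃ (n : ℕ) (d : Fin n → U) (ψ : L.Formula (Fin n ⊕ Unit)), ∀ v : Unit → U,
      φ.Realize (Sum.elim id v) ↔ ψ.Realize (Sum.elim d v) := by
  obtain ⟨n, e, ψ, h⟩ := exists_fin_vars (U := U) φ
  exact ⟨n, e, ψ, fun v => h id v⟩

theorem globalType_ext {p q : GlobalType L U}
    (h : ∀ (n : ℕ) (φ : L.Formula (Fin n ⊕ Unit)) (d : Fin n → U), Mem p φ d ↔ Mem q φ d) :
    p = q := by
  refine SetLike.ext fun σ => ?_
  have key : ∀ r : GlobalType L U, σ ∈ r ↔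
      Mem r (BoundedFormula.constantsVarsEquiv (Formula.equivSentence.symm σ) :
        L.Formula (U ⊕ Unit)) id := by
    intro r
    have : Formula.equivSentence (Formula.equivSentence.symm σ) = σ := Equiv.apply_symm_apply _ _
    rw [← this]
    have hi : ∀ b : U, ∀ φ : L[[U]].Formula Unit, φ.Realize (fun _ => b) ↔
        (inst (BoundedFormula.constantsVarsEquiv φ : L.Formula (U ⊕ Unit)) id).Realize
          (fun _ => b) := by
      intro b φ
      rw [realize_inst]
      exact (BoundedFormula.realize_constantsVarsEquiv (φ := φ)).symm
    rw [Equiv.symm_apply_apply]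
    exact ⟨mem_of_imp_aux r fun b => (hi b _).1, mem_of_imp_aux r fun b => (hi b _).2⟩
  obtain ⟨n, d, ψ, hψ⟩ := exists_fin_params (U := U)
    (BoundedFormula.constantsVarsEquiv (Formula.equivSentence.symm σ) : L.Formula (U ⊕ Unit))
  rw [key, key, mem_congr (fun b => hψ _), h, mem_congr (fun b => hψ _)]

/-- A complete, consistent and conjunction-closed family of formulas over `U` is a type. -/
theorem exists_globalType (Q : L.Formula (U ⊕ Unit) → Prop)
    (hsat : ∀ φ, Q φ → ∃ b : U, φ.Realize (Sum.elim id (fun _ => b)))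
    (hinf : ∀ φ ψ, Q φ → Q ψ → Q (φ ⊓ ψ)) (hcompl : ∀ φ, Q φ ∨ Q φ.not) :
    ∃ p : GlobalType L U, ∀ φ, Mem p φ id ↔ Q φ := by
  have hi : ∀ b : U, ∀ φ : L[[U]].Formula Unit, φ.Realize (fun _ => b) ↔
        Formula.Realize (BoundedFormula.constantsVarsEquiv φ : L.Formula (U ⊕ Unit))
          (Sum.elim id fun _ => b) := fun b φ =>
      (BoundedFormula.realize_constantsVarsEquiv (φ := φ)).symm
  refine ⟨typeOfSet {φ | Q (BoundedFormula.constantsVarsEquiv φ)} ?_ ?_ ?_, fun φ => ?_⟩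
  · intro φ hφ
    obtain ⟨b, hb⟩ := hsat _ hφ
    exact ⟨b, (hi b φ).2 hb⟩
  · intro φ hφ ψ hψ
    exact hinf _ _ hφ hψ
  · intro φ
    exact hcompl _
  · refine (mem_typeOfSet (φ := inst φ id)).trans ?_
    change Q (BoundedFormula.constantsVarsEquiv (inst φ id)) ↔ _
    have hmono : ∀ φ ψ : L.Formula (U ⊕ Unit), (∀ b : U, φ.Realize (Sum.elim id fun _ => b) →
        ψ.Realize (Sum.elim id fun _ => b)) → Q φ → Q ψ := by
      intro φ ψ h hφ
      refine (hcompl ψ).resolve_right fun hn => ?_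
      obtain ⟨b, hb⟩ := hsat _ (hinf _ _ hφ hn)
      rw [Formula.realize_inf, Formula.realize_not] at hb
      exact hb.2 (h b hb.1)
    have he : ∀ b : U, (φ.relabel (Sum.map id id) : L.Formula (U ⊕ Unit)).Realize
        (Sum.elim id fun _ => b) ↔ φ.Realize (Sum.elim id fun _ => b) := by
      intro b
      rw [Formula.realize_relabel, Sum.map_id_id, Function.comp_id]
    rw [inst, Equiv.apply_symm_apply]
    exact ⟨hmono _ _ fun b => (he b).1, hmono _ _ fun b => (he b).2⟩

theorem mem_relabel {p : GlobalType L U} {α β : Type*} (e : α → β) (φ : L.Formula (α ⊕ Unit))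
    (d : β → U) : Mem p (φ.relabel (Sum.map e id)) d ↔ Mem p φ (d ∘ e) := by
  refine mem_congr fun b => ?_
  rw [Formula.realize_relabel]
  have : Sum.elim d (fun _ => b) ∘ Sum.map e id = Sum.elim (d ∘ e) (fun _ : Unit => b) := by
    funext x; cases x <;> rfl
  rw [this]

theorem IsInvariant.mem_iff {A : Set U} {p : GlobalType L U} (hp : IsInvariant A p) {α : Type*}
    (φ : L.Formula (α ⊕ Unit)) {a b : α → U} (h : EquivOver (L := L) A a b) :
    Mem p φ a ↔ Mem p φ b := by
  obtain ⟨n, e, χ, hχ⟩ := exists_fin_vars (U := U) φ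
  rw [mem_congr fun c => hχ a _, mem_congr fun c => hχ b _]
  refine hp n _ _ _ fun ψ => ?_
  have := h (ψ.relabel (Sum.map id e))
  rw [Formula.realize_relabel, Formula.realize_relabel] at this
  simpa only [Sum.elim_comp_map, Function.comp_id] using this

theorem IsFinSat.exists_mem {A : Set U} {p : GlobalType L U} (hp : IsFinSat A p) {α : Type*}
    {φ : L.Formula (α ⊕ Unit)} {d : α → U} (h : Mem p φ d) :
    ∃ a ∈ A, φ.Realize (Sum.elim d (fun _ => a)) := by
  obtain ⟨n, e, χ, hχ⟩ := exists_fin_vars (U := U) φ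
  rw [mem_congr fun c => hχ d _] at h
  obtain ⟨a, ha, h2⟩ := hp n _ _ h
  exact ⟨a, ha, (hχ d _).2 h2⟩

theorem Realizes.realize_iff {q : GlobalType L U} {A : Set U} {b : U} (h : Realizes q A b)
    {α : Type*} (φ : L.Formula (α ⊕ Unit)) {d : α → U} (hd : ∀ i, d i ∈ A) :
    φ.Realize (Sum.elim d (fun _ => b)) ↔ Mem q φ d := by
  have key : ∀ φ : L.Formula (α ⊕ Unit), Mem q φ d → φ.Realize (Sum.elim d (fun _ => b)) := by
    intro φ hφ
    have h1 := h (φ.relabel (Sum.map (fun i => (⟨d i, hd i⟩ : A)) id))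
      ((mem_relabel _ φ _).2 hφ)
    rw [Formula.realize_relabel, Sum.elim_comp_map] at h1
    exact h1
  refine ⟨fun hb => ?_, key φ⟩
  by_contra hn
  have := key φ.not (mem_not.2 hn)
  rw [Formula.realize_not] at this
  exact this hb

theorem Realizes.mono {q : GlobalType L U} {A B : Set U} {b : U} (h : Realizes q B b)
    (hAB : A ⊆ B) : Realizes q A b := fun φ hφ =>
  (h.realize_iff φ fun i => hAB i.2).2 hφ

theorem IsFinSat.isInvariant {A : Set U} {p : GlobalType L U} (hp : IsFinSat A p) :
    IsInvariant A p := by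
  have key : ∀ (n : ℕ) (φ : L.Formula (Fin n ⊕ Unit)) (a b : Fin n → U),
      EquivOver (L := L) A a b → Mem p φ a → Mem p φ b := by
    intro n φ a b hab ha
    by_contra hn
    have h1 : Mem p (φ.relabel (Sum.map Sum.inl id) ⊓ (φ.relabel (Sum.map Sum.inr id)).not :
        L.Formula ((Fin n ⊕ Fin n) ⊕ Unit)) (Sum.elim a b) := by
      rw [mem_inf, mem_not, mem_relabel, mem_relabel]
      exact ⟨ha, hn⟩
    obtain ⟨c, hc, h2⟩ := hp.exists_mem h1
    rw [Formula.realize_inf, Formula.realize_not, Formula.realize_relabel,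
      Formula.realize_relabel, Sum.elim_comp_map, Sum.elim_comp_map, Sum.elim_comp_inl,
      Sum.elim_comp_inr, Function.comp_id] at h2
    have h3 := hab (φ.relabel (Sum.elim Sum.inr (fun _ => Sum.inl ⟨c, hc⟩)))
    rw [Formula.realize_relabel, Formula.realize_relabel] at h3
    have e : ∀ d : Fin n → U, Sum.elim (fun c : A => (c : U)) d ∘
        Sum.elim Sum.inr (fun _ => Sum.inl ⟨c, hc⟩) = Sum.elim d (fun _ : Unit => c) := by
      intro d; funext x; cases x <;> rfl
    rw [e, e] at h3
    exact h2.2 (h3.1 h2.1)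
  exact fun n φ a b hab => ⟨key n φ a b hab,
    key n φ b a fun ψ => (hab ψ).symm⟩

theorem IsSaturated.exists_realizes {κ : Cardinal.{u}} (h : IsSaturated L U κ)
    (q : GlobalType L U) {A : Set U} (hA : Cardinal.mk A < κ) : ∃ b, Realizes q A b := by
  let v : A → U := fun a => a
  have hi : ∀ b : U, ∀ φ : L[[A]].Formula Unit, φ.Realize (fun _ => b) ↔
        Formula.Realize (BoundedFormula.constantsVarsEquiv φ : L.Formula (A ⊕ Unit))
          (Sum.elim v fun _ => b) := fun b φ =>
      (BoundedFormula.realize_constantsVarsEquiv (φ := φ)).symm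
  let S : Set (L[[A]].Formula Unit) :=
    {φ | Mem q (BoundedFormula.constantsVarsEquiv φ : L.Formula (A ⊕ Unit)) v}
  have h1 : ∀ φ ∈ S, ∃ b : U, φ.Realize (fun _ => b) := by
    intro φ hφ
    obtain ⟨b, hb⟩ := Mem.exists_realize hφ
    exact ⟨b, (hi b φ).2 hb⟩
  have h2 : ∀ φ ∈ S, ∀ ψ ∈ S, φ ⊓ ψ ∈ S := fun φ hφ ψ hψ => mem_inf.2 ⟨hφ, hψ⟩
  have h3 : ∀ φ, φ ∈ S ∨ φ.not ∈ S := by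
    intro φ
    by_cases hφ : φ ∈ S
    · exact Or.inl hφ
    · exact Or.inr (mem_not.2 hφ)
  obtain ⟨b, hb⟩ := h A hA (typeOfSet S h1 h2 h3)
  refine ⟨b (), fun φ hφ => ?_⟩
  let ψ : L[[A]].Formula Unit := BoundedFormula.constantsVarsEquiv.symm φ
  have eψ : (BoundedFormula.constantsVarsEquiv ψ : L.Formula (A ⊕ Unit)) = φ :=
    Equiv.apply_symm_apply _ _
  have hψ : ψ ∈ S := by
    change Mem q (BoundedFormula.constantsVarsEquiv ψ : L.Formula (A ⊕ Unit)) v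
    rw [eψ]; exact hφ
  have h4 := (mem_typeOfSet (U := U) (h1 := h1) (h2 := h2) (h3 := h3)).2 hψ
  rw [← hb] at h4
  have h5 : ψ.Realize (fun _ => b ()) := Theory.CompleteType.formula_mem_typeOf.1 h4
  have h6 := (hi (b ()) ψ).1 h5
  rw [eψ] at h6
  exact h6

theorem exists_realizes (M : L.ElementarySubstructure U) [hM : IsSmall M] (q : GlobalType L U)
    {A : Set U} (hA : A.Finite) : ∃ b, Realizes q ((M : Set U) ∪ A) b := by
  obtain ⟨κ, h0, h1, h2⟩ := hM.exists_saturated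
  refine h2.exists_realizes q (lt_of_le_of_lt (Cardinal.mk_union_le _ _) ?_)
  exact Cardinal.add_lt_of_lt h0 h1 (lt_of_lt_of_le hA.lt_aleph0 h0)

end Types

/-! ### The language of Boolean algebras and the group given by symmetric difference -/

section Boolean

set_option linter.unusedSectionVars false

/-- The function symbols `∩, ∪, ᶜ, 0, 1`. -/
inductive BoolFunc : ℕ → Type
  | inf : BoolFunc 2
  | sup : BoolFunc 2
  | compl : BoolFunc 1
  | bot : BoolFunc 0
  | top : BoolFunc 0

/-- The relation symbol `≤`. -/
inductive BoolRel : ℕ → Type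
  | le : BoolRel 2

/-- The language `{∩, ∪, ≤, ᶜ, 0, 1}` of Boolean algebras. -/
def boolLang : FirstOrder.Language.{0, 0} := ⟨BoolFunc, BoolRel⟩

/-- Every Boolean algebra is a structure in the language of Boolean algebras. -/
instance boolStructure (U : Type u) [BooleanAlgebra U] : boolLang.Structure U where
  funMap := @fun
    | _, BoolFunc.inf, v => v 0 ⊓ v 1
    | _, BoolFunc.sup, v => v 0 ⊔ v 1
    | _, BoolFunc.compl, v => (v 0)ᶜ
    | _, BoolFunc.bot, _ => ⊥
    | _, BoolFunc.top, _ => ⊤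
  RelMap := @fun
    | _, BoolRel.le, v => v 0 ≤ v 1

/-- The term `(s ∩ tᶜ) ∪ (t ∩ sᶜ)` for the group operation `s + t` (symmetric difference). -/
def addTerm {α : Type*} (s t : boolLang.Term α) : boolLang.Term α :=
  let cap (a b : boolLang.Term α) : boolLang.Term α :=
    Term.func (L := boolLang) (l := 2) BoolFunc.inf ![a, b]
  let cup (a b : boolLang.Term α) : boolLang.Term α :=
    Term.func (L := boolLang) (l := 2) BoolFunc.sup ![a, b]
  let cpl (a : boolLang.Term α) : boolLang.Term α :=
    Term.func (L := boolLang) (l := 1) BoolFunc.compl ![a]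
  cup (cap s (cpl t)) (cap t (cpl s))

variable {U : Type u} [BooleanAlgebra U]

theorem realize_addTerm {α : Type*} (s t : boolLang.Term α) (v : α → U) :
    (addTerm s t).realize v = symmDiff (s.realize v) (t.realize v) := by
  rw [symmDiff, sdiff_eq, sdiff_eq]
  rfl

/-- From `φ(z, x)` the formula `φ(z, x + y)`, where the variable `y` is added to `z`. -/
def addRight {α : Type*} (φ : boolLang.Formula (α ⊕ Unit)) :
    boolLang.Formula ((α ⊕ Unit) ⊕ Unit) :=
  φ.subst (Sum.elim (fun i => Term.var (Sum.inl (Sum.inl i)))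
    (fun _ => addTerm (Term.var (Sum.inr ())) (Term.var (Sum.inl (Sum.inr ())))))

/-- From `φ(z, x)` the formula `φ(z, y + x)`, where the variable `y` is added to `z`. -/
def addLeft {α : Type*} (φ : boolLang.Formula (α ⊕ Unit)) :
    boolLang.Formula ((α ⊕ Unit) ⊕ Unit) :=
  φ.subst (Sum.elim (fun i => Term.var (Sum.inl (Sum.inl i)))
    (fun _ => addTerm (Term.var (Sum.inl (Sum.inr ()))) (Term.var (Sum.inr ()))))

theorem realize_addRight {α : Type*} (φ : boolLang.Formula (α ⊕ Unit)) (d : α → U) (b a : U) :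
    (addRight φ).Realize (Sum.elim (Sum.elim d (fun _ => b)) (fun _ => a)) ↔
      φ.Realize (Sum.elim d (fun _ => symmDiff a b)) := by
  refine BoundedFormula.realize_subst.trans ?_
  rw [Formula.Realize]
  have : (fun i => Term.realize (Sum.elim (Sum.elim d (fun _ : Unit => b)) (fun _ : Unit => a))
      ((Sum.elim (fun i => Term.var (Sum.inl (Sum.inl i)))
        (fun _ => addTerm (Term.var (Sum.inr ())) (Term.var (Sum.inl (Sum.inr ())))) :
        α ⊕ Unit → boolLang.Term ((α ⊕ Unit) ⊕ Unit)) i)) =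
      Sum.elim d (fun _ => symmDiff a b) := by
    funext i
    rcases i with i | i
    · rfl
    · exact realize_addTerm _ _ _
  rw [this]

theorem realize_addLeft {α : Type*} (φ : boolLang.Formula (α ⊕ Unit)) (d : α → U) (b a : U) :
    (addLeft φ).Realize (Sum.elim (Sum.elim d (fun _ => b)) (fun _ => a)) ↔
      φ.Realize (Sum.elim d (fun _ => symmDiff b a)) := by
  refine BoundedFormula.realize_subst.trans ?_
  rw [Formula.Realize]
  have : (fun i => Term.realize (Sum.elim (Sum.elim d (fun _ : Unit => b)) (fun _ : Unit => a))
      ((Sum.elim (fun i => Term.var (Sum.inl (Sum.inl i)))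
        (fun _ => addTerm (Term.var (Sum.inl (Sum.inr ()))) (Term.var (Sum.inr ()))) :
        α ⊕ Unit → boolLang.Term ((α ⊕ Unit) ⊕ Unit)) i)) =
      Sum.elim d (fun _ => symmDiff b a) := by
    funext i
    rcases i with i | i
    · rfl
    · exact realize_addTerm _ _ _
  rw [this]

theorem exists_leftTranslate (c : U) (p : GlobalType boolLang U) :
    ∃! r : GlobalType boolLang U, ∀ (n : ℕ) (φ : boolLang.Formula (Fin n ⊕ Unit)) (d : Fin n → U),
      Mem r φ d ↔ Mem p (addLeft φ) (Sum.elim d (fun _ => c)) := by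
  obtain ⟨r, hr⟩ := exists_globalType (L := boolLang) (U := U)
    (fun φ => Mem p (addLeft φ) (Sum.elim id (fun _ => c)))
    (fun φ hφ => by
      obtain ⟨a, ha⟩ := hφ.exists_realize
      exact ⟨_, (realize_addLeft φ _ _ _).1 ha⟩)
    (fun φ ψ hφ hψ => mem_inf.2 ⟨hφ, hψ⟩)
    (fun φ => by
      by_cases h : Mem p (addLeft φ) (Sum.elim id (fun _ => c))
      · exact Or.inl h
      · exact Or.inr (mem_not.2 h))
  have hr' : ∀ (n : ℕ) (φ : boolLang.Formula (Fin n ⊕ Unit)) (d : Fin n → U),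
      Mem r φ d ↔ Mem p (addLeft φ) (Sum.elim d (fun _ => c)) := by
    intro n φ d
    have h1 := mem_relabel (p := r) d φ id
    rw [Function.id_comp] at h1
    rw [← h1, hr]
    refine mem_congr fun b => ?_
    rw [realize_addLeft, realize_addLeft, Formula.realize_relabel, Sum.elim_comp_map,
      Function.id_comp, Function.comp_id]
  refine ⟨r, hr', fun r' h' => globalType_ext fun n φ d => ?_⟩
  rw [hr', h']

theorem exists_rightTranslate (p : GlobalType boolLang U) (c : U) :
    ∃! r : GlobalType boolLang U, ∀ (n : ℕ) (φ : boolLang.Formula (Fin n ⊕ Unit)) (d : Fin n → U),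
      Mem r φ d ↔ Mem p (addRight φ) (Sum.elim d (fun _ => c)) := by
  have h : ∀ {α : Type} (φ : boolLang.Formula (α ⊕ Unit)) (d : α → U),
      Mem p (addLeft φ) (Sum.elim d (fun _ => c)) ↔
        Mem p (addRight φ) (Sum.elim d (fun _ => c)) := by
    intro α φ d
    refine mem_congr fun b => ?_
    rw [realize_addLeft, realize_addRight, symmDiff_comm]
  simpa only [h] using exists_leftTranslate c p

/-- The left translate `c · p`: `φ(x, d) ∈ c · p` if and only if `φ(c + x, d) ∈ p`. -/
noncomputable def leftTranslate (c : U) (p : GlobalType boolLang U) : GlobalType boolLang U :=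
  (exists_leftTranslate c p).choose

/-- The right translate `p · c`: `φ(x, d) ∈ p · c` if and only if `φ(x + c, d) ∈ p`. -/
noncomputable def rightTranslate (p : GlobalType boolLang U) (c : U) : GlobalType boolLang U :=
  (exists_rightTranslate p c).choose

/-- `p` is left dfg over `A`: it and all its left translates are `A`-definable. -/
def IsLeftDfg (A : Set U) (p : GlobalType boolLang U) : Prop :=
  IsDefinable A p ∧ ∀ c : U, IsDefinable A (leftTranslate c p)

/-- `p` is right dfg over `A`: it and all its right translates are `A`-definable. -/
def IsRightDfg (A : Set U) (p : GlobalType boolLang U) : Prop :=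
  IsDefinable A p ∧ ∀ c : U, IsDefinable A (rightTranslate p c)

/-- The space of global types that are invariant over `M`. -/
@[ext]
structure SInv (M : boolLang.ElementarySubstructure U) : Type u where
  val : GlobalType boolLang U
  property : IsInvariant (M : Set U) val

/-- The space of global types that are finitely satisfiable in `M`. -/
@[ext]
structure SFs (M : boolLang.ElementarySubstructure U) : Type u where
  val : GlobalType boolLang U
  property : IsFinSat (M : Set U) val

/-- For `M`-invariant `p`, membership of `φ(x + b, d)` in `p` depends only on `tp(b / Md)`. -/
theorem addRight_mem_iff {A : Set U} {p q : GlobalType boolLang U} (hp : IsInvariant A p)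
    {α : Type*} (φ : boolLang.Formula (α ⊕ Unit)) {d : α → U} {b b' : U}
    (hb : Realizes q (A ∪ Set.range d) b) (hb' : Realizes q (A ∪ Set.range d) b') :
    Mem p (addRight φ) (Sum.elim d (fun _ => b)) ↔
      Mem p (addRight φ) (Sum.elim d (fun _ => b')) := by
  refine hp.mem_iff _ fun ψ => ?_
  let θ : boolLang.Formula ((A ⊕ α) ⊕ Unit) := ψ.relabel (Equiv.sumAssoc _ _ _).symm
  have hθ : ∀ b : U, θ.Realize (Sum.elim (Sum.elim (fun a : A => (a : U)) d) (fun _ => b)) ↔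
      ψ.Realize (Sum.elim (fun a : A => (a : U)) (Sum.elim d (fun _ => b))) := by
    intro b
    rw [Formula.realize_relabel]
    have : Sum.elim (Sum.elim (fun a : A => (a : U)) d) (fun _ : Unit => b) ∘
        (Equiv.sumAssoc A α Unit).symm =
        Sum.elim (fun a : A => (a : U)) (Sum.elim d (fun _ => b)) := by
      funext x; rcases x with x | x | x <;> rfl
    rw [this]
  have hd : ∀ i, Sum.elim (fun a : A => (a : U)) d i ∈ A ∪ Set.range d := by
    rintro (i | i)
    · exact Or.inl i.2
    · exact Or.inr ⟨i, rfl⟩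
  rw [← hθ, ← hθ, hb.realize_iff θ hd, hb'.realize_iff θ hd]

theorem exists_newelski (M : boolLang.ElementarySubstructure U) [IsSmall M] (p : SInv M)
    (q : GlobalType boolLang U) :
    ∃! r : GlobalType boolLang U, ∀ (n : ℕ) (φ : boolLang.Formula (Fin n ⊕ Unit)) (d : Fin n → U)
      (b : U), Realizes q ((M : Set U) ∪ Set.range d) b →
        (Mem r φ d ↔ Mem p.1 (addRight φ) (Sum.elim d (fun _ => b))) := by
  have hcongr : ∀ (φ : boolLang.Formula (U ⊕ Unit)) (n : ℕ) (d : Fin n → U)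
      (ψ : boolLang.Formula (Fin n ⊕ Unit)),
      (∀ v : Unit → U, φ.Realize (Sum.elim id v) ↔ ψ.Realize (Sum.elim d v)) → ∀ b : U,
      (Mem p.1 (addRight φ) (Sum.elim id (fun _ => b)) ↔
        Mem p.1 (addRight ψ) (Sum.elim d (fun _ => b))) := by
    intro φ n d ψ h b
    refine mem_congr fun a => ?_
    rw [realize_addRight, realize_addRight, h]
  obtain ⟨r, hr⟩ := exists_globalType (L := boolLang) (U := U)
    (fun φ => ∃ A : Set U, A.Finite ∧ ∀ b, Realizes q ((M : Set U) ∪ A) b →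
      Mem p.1 (addRight φ) (Sum.elim id (fun _ => b)))
    (fun φ ⟨A, hA, h⟩ => by
      obtain ⟨b, hb⟩ := exists_realizes M q hA
      obtain ⟨a, ha⟩ := (h b hb).exists_realize
      exact ⟨_, (realize_addRight φ _ _ _).1 ha⟩)
    (fun φ ψ ⟨A, hA, h⟩ ⟨B, hB, h'⟩ => ⟨A ∪ B, hA.union hB, fun b hb => mem_inf.2
      ⟨h b (hb.mono (Set.union_subset_union_right _ Set.subset_union_left)),
        h' b (hb.mono (Set.union_subset_union_right _ Set.subset_union_right))⟩⟩)
    (fun φ => by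
      obtain ⟨n, d, ψ, hψ⟩ := exists_fin_params φ
      have hd : (Set.range d).Finite := Set.finite_range d
      obtain ⟨b, hb⟩ := exists_realizes M q hd
      by_cases h : Mem p.1 (addRight φ) (Sum.elim id (fun _ => b))
      · refine Or.inl ⟨Set.range d, hd, fun b' hb' => ?_⟩
        rw [hcongr φ n d ψ hψ] at h ⊢
        exact (addRight_mem_iff p.2 ψ hb hb').1 h
      · refine Or.inr ⟨Set.range d, hd, fun b' hb' => mem_not.2 fun h' => h ?_⟩
        have h' : Mem p.1 (addRight φ) (Sum.elim id (fun _ => b')) := h'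
        rw [hcongr φ n d ψ hψ] at h' ⊢
        exact (addRight_mem_iff p.2 ψ hb hb').2 h')
  have hr' : ∀ (n : ℕ) (φ : boolLang.Formula (Fin n ⊕ Unit)) (d : Fin n → U)
      (b : U), Realizes q ((M : Set U) ∪ Set.range d) b →
        (Mem r φ d ↔ Mem p.1 (addRight φ) (Sum.elim d (fun _ => b))) := by
    intro n φ d b hb
    have h1 := mem_relabel (p := r) d φ id
    rw [Function.id_comp] at h1
    rw [← h1, hr]
    have h2 : ∀ v : Unit → U, (φ.relabel (Sum.map d id) : boolLang.Formula (U ⊕ Unit)).Realize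
        (Sum.elim id v) ↔ φ.Realize (Sum.elim d v) := by
      intro v
      rw [Formula.realize_relabel, Sum.elim_comp_map, Function.id_comp, Function.comp_id]
    constructor
    · rintro ⟨A, hA, h⟩
      obtain ⟨b', hb'⟩ := exists_realizes M q (hA.union (Set.finite_range d))
      have h3 := h b' (hb'.mono (Set.union_subset_union_right _ Set.subset_union_left))
      rw [hcongr _ n d φ h2] at h3
      exact (addRight_mem_iff p.2 φ hb
        (hb'.mono (Set.union_subset_union_right _ Set.subset_union_right))).2 h3
    · intro h
      refine ⟨Set.range d, Set.finite_range d, fun b' hb' => ?_⟩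
      rw [hcongr _ n d φ h2]
      exact (addRight_mem_iff p.2 φ hb hb').1 h
  refine ⟨r, hr', fun r' h' => globalType_ext fun n φ d => ?_⟩
  obtain ⟨b, hb⟩ := exists_realizes M q (Set.finite_range d)
  rw [hr' n φ d b hb, h' n φ d b hb]

/-- The Newelski product `p * q` of an `M`-invariant type `p` and a global type `q`:
`φ(x, d) ∈ p * q` if and only if `φ(x + b, d) ∈ p`, where `b ⊨ q|_{Md}`. -/
noncomputable def newelski (M : boolLang.ElementarySubstructure U) [IsSmall M] (p : SInv M)
    (q : GlobalType boolLang U) : GlobalType boolLang U :=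
  (exists_newelski M p q).choose

variable {M : boolLang.ElementarySubstructure U} [IsSmall M]

theorem mem_newelski {p : SInv M} {q : GlobalType boolLang U} {α : Type*}
    {φ : boolLang.Formula (α ⊕ Unit)} {d : α → U} {b : U}
    (hb : Realizes q ((M : Set U) ∪ Set.range d) b) :
    Mem (newelski M p q) φ d ↔ Mem p.1 (addRight φ) (Sum.elim d (fun _ => b)) := by
  obtain ⟨n, e, χ, hχ⟩ := exists_fin_vars (U := U) φ
  have hr : Set.range (d ∘ e) ⊆ Set.range d := Set.range_comp_subset_range e d
  rw [mem_congr fun c => hχ d _, newelski, (exists_newelski M p q).choose_spec.1 n _ _ b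
    (hb.mono (Set.union_subset_union_right _ hr))]
  refine mem_congr fun a => ?_
  rw [realize_addRight, realize_addRight, hχ]

theorem newelski_isInvariant (p q : SInv M) : IsInvariant (M : Set U) (newelski M p q.1) := by
  intro n φ a a' h
  obtain ⟨b, hb⟩ := exists_realizes M q.1 ((Set.finite_range a).union (Set.finite_range a'))
  have hb1 := hb.mono (Set.union_subset_union_right _ Set.subset_union_left)
  have hb2 := hb.mono (Set.union_subset_union_right _ Set.subset_union_right)
  rw [mem_newelski hb1, mem_newelski hb2]
  refine p.2.mem_iff _ ?_
  have key : ∀ (A : Set U), IsInvariant A q.1 → EquivOver (L := boolLang) A a a' →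
      Realizes q.1 (A ∪ Set.range a) b → Realizes q.1 (A ∪ Set.range a') b →
      EquivOver (L := boolLang) A (Sum.elim a (fun _ : Unit => b))
        (Sum.elim a' (fun _ : Unit => b)) := by
    intro A hA h hb1 hb2 ψ
    let v : A → U := fun c => c
    let θ : boolLang.Formula ((A ⊕ Fin n) ⊕ Unit) := ψ.relabel (Equiv.sumAssoc _ _ _).symm
    have hθ : ∀ c : Fin n → U, θ.Realize (Sum.elim (Sum.elim v c) (fun _ => b)) ↔
        ψ.Realize (Sum.elim v (Sum.elim c (fun _ => b))) := by
      intro c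
      rw [Formula.realize_relabel]
      have : Sum.elim (Sum.elim v c) (fun _ : Unit => b) ∘ (Equiv.sumAssoc A (Fin n) Unit).symm =
          Sum.elim v (Sum.elim c (fun _ => b)) := by
        funext x; rcases x with x | x | x <;> rfl
      rw [this]
    have hd : ∀ c : Fin n → U, ∀ i, Sum.elim v c i ∈ A ∪ Set.range c := by
      rintro c (i | i)
      · exact Or.inl i.2
      · exact Or.inr ⟨i, rfl⟩
    rw [← hθ a, ← hθ a', hb1.realize_iff θ (hd a), hb2.realize_iff θ (hd a')]
    refine hA.mem_iff _ fun χ => ?_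
    have h1 := h (χ.relabel (Sum.elim Sum.inl id))
    rw [Formula.realize_relabel, Formula.realize_relabel] at h1
    have e : ∀ c : Fin n → U, Sum.elim v c ∘ Sum.elim Sum.inl id =
        Sum.elim v (Sum.elim v c) := by
      intro c; funext x; rcases x with x | x | x <;> rfl
    rw [e, e] at h1
    exact h1
  exact key _ q.2 h hb1 hb2

theorem closed_symmDiff {a b : U} (ha : a ∈ M) (hb : b ∈ M) : symmDiff a b ∈ M := by
  have cap : ∀ {a b : U}, a ∈ M → b ∈ M → a ⊓ b ∈ M := fun {a b} ha hb =>
    M.toSubstructure.fun_mem (n := 2) BoolFunc.inf ![a, b]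
      (fun i => by fin_cases i; exacts [ha, hb])
  have cup : ∀ {a b : U}, a ∈ M → b ∈ M → a ⊔ b ∈ M := fun {a b} ha hb =>
    M.toSubstructure.fun_mem (n := 2) BoolFunc.sup ![a, b]
      (fun i => by fin_cases i; exacts [ha, hb])
  have cpl : ∀ {a : U}, a ∈ M → aᶜ ∈ M := fun {a} ha =>
    M.toSubstructure.fun_mem (n := 1) BoolFunc.compl ![a]
      (fun i => by fin_cases i; exact ha)
  rw [symmDiff, sdiff_eq, sdiff_eq]
  exact cup (cap ha (cpl hb)) (cap hb (cpl ha))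

/-- An `M`-finitely satisfiable type, viewed as an `M`-invariant type. -/
def SFs.toSInv (p : SFs M) : SInv M := ⟨p.1, p.2.isInvariant⟩

theorem newelski_isFinSat (p q : SFs M) :
    IsFinSat (M : Set U) (newelski M p.toSInv q.1) := by
  intro n φ d h
  obtain ⟨b, hb⟩ := exists_realizes M q.1 (Set.finite_range d)
  rw [mem_newelski hb] at h
  obtain ⟨a, ha, h1⟩ := p.2.exists_mem h
  rw [realize_addRight] at h1
  have h2 : (addLeft φ).Realize (Sum.elim (Sum.elim d (fun _ => a)) (fun _ => b)) :=
    (realize_addLeft φ d a b).2 h1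
  rw [hb.realize_iff] at h2
  · obtain ⟨c, hc, h3⟩ := q.2.exists_mem h2
    rw [realize_addLeft] at h3
    exact ⟨_, closed_symmDiff ha hc, h3⟩
  · rintro (i | i)
    · exact Or.inr ⟨i, rfl⟩
    · exact Or.inl ha

theorem newelski_assoc (p q : SInv M) (r : GlobalType boolLang U) :
    newelski M ⟨newelski M p q.1, newelski_isInvariant p q⟩ r =
      newelski M p (newelski M q r) := by
  refine globalType_ext fun n φ d => ?_
  obtain ⟨c, hc⟩ := exists_realizes M r (Set.finite_range d)
  obtain ⟨b, hb⟩ := exists_realizes M q.1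
    (Set.finite_range (Sum.elim d (fun _ : Unit => c)))
  have hbc : Realizes (newelski M q r) ((M : Set U) ∪ Set.range d) (symmDiff b c) := by
    intro ψ hψ
    have hc' : Realizes r ((M : Set U) ∪
        Set.range (fun a : ((M : Set U) ∪ Set.range d : Set U) => (a : U))) c := by
      rw [Subtype.range_coe, ← Set.union_assoc, Set.union_self]
      exact hc
    rw [mem_newelski hc', ← hb.realize_iff, realize_addRight] at hψ
    · exact hψ
    · rintro (⟨i, hi | ⟨j, rfl⟩⟩ | i)
      · exact Or.inl hi
      · exact Or.inr ⟨Sum.inl j, rfl⟩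
      · exact Or.inr ⟨Sum.inr (), rfl⟩
  rw [mem_newelski hc, mem_newelski hbc, mem_newelski hb]
  refine mem_congr fun a => ?_
  rw [realize_addRight, realize_addRight, realize_addRight, symmDiff_assoc]

/-- The semigroup of `M`-invariant types with the Newelski product. -/
noncomputable instance : Semigroup (SInv M) where
  mul p q := ⟨newelski M p q.1, newelski_isInvariant p q⟩
  mul_assoc p q r := SInv.ext (newelski_assoc p q r.1)

/-- The semigroup of types finitely satisfiable in `M` with the Newelski product. -/
noncomputable instance : Semigroup (SFs M) where
  mul p q := ⟨newelski M p.toSInv q.1, newelski_isFinSat p q⟩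
  mul_assoc p q r := SFs.ext (newelski_assoc p.toSInv q.toSInv r.1)

end Boolean

/-! ### Ellis subgroups -/

section Ellis

variable {X : Type*} [Semigroup X]

/-- A left ideal: a nonempty subset `I` with `X I ⊆ I`. -/
def IsLeftIdeal (I : Set X) : Prop :=
  I.Nonempty ∧ ∀ x : X, ∀ y ∈ I, x * y ∈ I

/-- A minimal left ideal: a left ideal that does not properly contain another left ideal. -/
def IsMinimalLeftIdeal (I : Set X) : Prop :=
  IsLeftIdeal I ∧ ∀ J : Set X, IsLeftIdeal J → J ⊆ I → J = I

/-- An Ellis subgroup: a set `u * I`, where `I` is a minimal left ideal and `u ∈ I` is an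
idempotent. -/
def IsEllisSubgroup (E : Subsemigroup X) : Prop :=
  ∃ (I : Set X) (u : X), IsMinimalLeftIdeal I ∧ u ∈ I ∧ u * u = u ∧
    (E : Set X) = {y | ∃ x ∈ I, y = u * x}

end Ellis

end InvEllis

/-!
The proof rests on one type, the *generic* type `p`, saying that `x` splits every nonzero element of
`U`, that is, meets it without containing it. In an atomless algebra the formulas satisfied by a
finite tuple depend only on its pattern, the set of cells `⋂ i, ± a i` that vanish
(`SamePattern.realize_iff`, a back-and-forth induction on formulas). If `b` splits every nonzero
cell of `d`, the pattern of `(d, b)` is determined by that of `d`. So the generic type exists, is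
unique (`IsGeneric.eq`), and is definable without parameters, there being finitely many patterns
(`IsGeneric.isDefinable`). Translation preserves splitting, so `p` is fixed by all translations
(`IsGeneric.leftTranslate_eq`); in particular it is dfg.

Invariance under translation gives `p * q = p`. It also gives `q * p = p` for `M`-invariant `q`
(`IsGeneric.newelski_right`): if `b` realizes `p` over `M` and `e`, then so does `bᶜ`, so what `q`
says of `x + b` and `e` it says of `x + bᶜ = (x + b)ᶜ` and `e`; but an element and its complement
cannot both be disjoint from `e ≠ 0`, nor can both contain it. Hence `p` is a zero of the
semigroup of invariant types, and its only Ellis subgroup is `{p}`.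

For finitely satisfiable types, the semigroup is compact Hausdorff with continuous right
multiplications, so Ellis subgroups exist (`exists_isEllisSubgroup`). By saturation there is
`d ≠ 0` below all members of an ultrafilter of `M`, so every element of `M` contains `d` or is
disjoint from `d`. Finite satisfiability carries this dichotomy over to types, and the truth value
of `d ≤ x` becomes a homomorphism onto `ℤ/2` (`SFs.character`). Such a homomorphism remains
surjective on each Ellis subgroup (`IsEllisSubgroup.nontrivial`).
-/

namespace InvEllis

open FirstOrder FirstOrder.Language

/-! ### Global types as filters -/

section Filters

variable {L : FirstOrder.Language.{0, 0}} {U : Type u} [L.Structure U] [Nonempty U]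

/-- The filter of subsets of `U` generated by the sets defined by the formulas in `p`. It turns
"`φ(x, d) ∈ p`" into "`φ(b, d)` for eventually all `b`", see `mem_iff_eventually`. -/
def typeFilter (p : GlobalType L U) : Filter U where
  sets := {S | ∃ φ : L.Formula (U ⊕ Unit), Mem p φ id ∧
    ∀ b : U, φ.Realize (Sum.elim id (fun _ => b)) → b ∈ S}
  univ_sets := by
    by_cases h : Mem p (⊤ : L.Formula (U ⊕ Unit)) id
    · exact ⟨_, h, fun b _ => trivial⟩
    · exact ⟨_, mem_not.2 h, fun b _ => trivial⟩
  sets_of_superset := by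
    rintro S T ⟨φ, h, h'⟩ hST
    exact ⟨φ, h, fun b hb => hST (h' b hb)⟩
  inter_sets := by
    rintro S T ⟨φ, h, h'⟩ ⟨ψ, k, k'⟩
    refine ⟨φ ⊓ ψ, mem_inf.2 ⟨h, k⟩, fun b hb => ?_⟩
    rw [Formula.realize_inf] at hb
    exact ⟨h' b hb.1, k' b hb.2⟩

theorem mem_iff_eventually {p : GlobalType L U} {α : Type*} {φ : L.Formula (α ⊕ Unit)}
    {d : α → U} :
    Mem p φ d ↔ ∀ᶠ b in typeFilter p, φ.Realize (Sum.elim d (fun _ => b)) := by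
  constructor
  · intro h
    refine ⟨φ.relabel (Sum.map d id), (mem_relabel _ _ _).2 h, fun b hb => ?_⟩
    rw [Formula.realize_relabel, Sum.elim_comp_map] at hb
    exact hb
  · rintro ⟨ψ, h, h'⟩
    exact h.imp h'

instance typeFilter_neBot (p : GlobalType L U) : (typeFilter p).NeBot := by
  refine ⟨fun h => ?_⟩
  have : (∅ : Set U) ∈ typeFilter p := by rw [h]; trivial
  obtain ⟨φ, hφ, h'⟩ := this
  obtain ⟨b, hb⟩ := hφ.exists_realize
  exact h' b hb

/-- Any proper filter on `U` is refined by a type: the formulas that hold along an ultrafilter. -/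
theorem exists_globalType_of_filter (W : Filter U) [W.NeBot] :
    ∃ p : GlobalType L U, ∀ (α : Type v) (φ : L.Formula (α ⊕ Unit)) (d : α → U),
      (∀ᶠ b in W, φ.Realize (Sum.elim d (fun _ => b))) → Mem p φ d := by
  let V := Ultrafilter.of W
  obtain ⟨p, hp⟩ := exists_globalType (L := L) (U := U)
    (fun φ => ∀ᶠ b in (V : Filter U), φ.Realize (Sum.elim id (fun _ => b)))
    (fun φ h => h.exists)
    (fun φ ψ h h' => by
      filter_upwards [h, h'] with b hb hb'
      exact Formula.realize_inf.2 ⟨hb, hb'⟩)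
    (fun φ => by
      rcases V.em (fun b => φ.Realize (Sum.elim id (fun _ => b))) with h | h
      · exact Or.inl h
      · refine Or.inr ?_
        filter_upwards [h] with b hb
        exact Formula.realize_not.2 hb)
  refine ⟨p, fun α φ d h => ?_⟩
  have h1 := (mem_relabel (p := p) d φ id)
  rw [Function.id_comp] at h1
  rw [← h1, hp]
  filter_upwards [Ultrafilter.of_le W h] with b hb
  rw [Formula.realize_relabel, Sum.elim_comp_map]
  exact hb

/-- Every sentence naming elements of `U` has the form `φ(x, d)` for some `L`-formula `φ`. -/
theorem exists_mem_iff (σ : L[[U]][[Unit]].Sentence) :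
    ∃ (n : ℕ) (φ : L.Formula (Fin n ⊕ Unit)) (d : Fin n → U),
      ∀ r : GlobalType L U, σ ∈ r ↔ Mem r φ d := by
  obtain ⟨φ, rfl⟩ := (Formula.equivSentence (L := L[[U]]) (α := Unit)).surjective σ
  obtain ⟨n, d, ψ, hψ⟩ := exists_fin_params (U := U)
    (BoundedFormula.constantsVarsEquiv φ : L.Formula (U ⊕ Unit))
  have h : ∀ b : U, φ.Realize (fun _ => b) ↔ (inst ψ d).Realize (fun _ => b) := by
    intro b
    rw [realize_inst, ← hψ]
    exact (BoundedFormula.realize_constantsVarsEquiv (φ := φ)).symm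
  exact ⟨n, ψ, d, fun r =>
    ⟨mem_of_imp_aux r fun b => (h b).1, mem_of_imp_aux r fun b => (h b).2⟩⟩

end Filters

/-! ### Patterns of tuples and elimination of quantifiers -/

section Patterns

variable {U : Type u} [BooleanAlgebra U] {ι : Type*}

/-- The literal `x` or `xᶜ`. -/
def lit (ε : Bool) (x : U) : U := cond ε x xᶜ

theorem lit_inf_lit_not (ε : Bool) (x : U) : lit ε x ⊓ lit (!ε) x = ⊥ := by
  cases ε <;> simp [lit]

/-- The element `⋂ i, ± a i` with signs `σ`: an atom of the subalgebra generated by the tuple `a`,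
or `⊥`. -/
def cell [Fintype ι] (a : ι → U) (σ : ι → Bool) : U :=
  Finset.univ.inf fun i => lit (σ i) (a i)

variable [Fintype ι]

theorem le_cell_iff {a : ι → U} {σ : ι → Bool} {x : U} :
    x ≤ cell a σ ↔ ∀ i, x ≤ lit (σ i) (a i) := by
  simp [cell]

theorem cell_le (a : ι → U) (σ : ι → Bool) (i : ι) : cell a σ ≤ lit (σ i) (a i) :=
  le_cell_iff.1 le_rfl i

theorem cell_inf_cell (a : ι → U) {σ τ : ι → Bool} (h : σ ≠ τ) : cell a σ ⊓ cell a τ = ⊥ := by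
  obtain ⟨i, hi⟩ := Function.ne_iff.1 h
  have : τ i = !σ i := by revert hi; cases σ i <;> cases τ i <;> simp
  rw [eq_bot_iff, ← lit_inf_lit_not (σ i) (a i), ← this]
  exact inf_le_inf (cell_le a σ i) (cell_le a τ i)

/-- The cells of a tuple cover the whole algebra. -/
theorem exists_inf_cell_ne_bot (a : ι → U) {x : U} (hx : x ≠ ⊥) : ∃ σ, x ⊓ cell a σ ≠ ⊥ := by
  classical
  suffices h : ∀ s : Finset ι, ∃ σ : ι → Bool, x ⊓ s.inf (fun i => lit (σ i) (a i)) ≠ ⊥ from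
    h Finset.univ
  intro s
  induction s using Finset.induction_on with
  | empty => exact ⟨fun _ => true, by simpa using hx⟩
  | insert i s hi ih =>
    obtain ⟨σ, hσ⟩ := ih
    set y := x ⊓ s.inf (fun i => lit (σ i) (a i)) with hy
    have key : ∀ ε, y ⊓ lit ε (a i) ≠ ⊥ →
        ∃ σ : ι → Bool, x ⊓ (insert i s).inf (fun i => lit (σ i) (a i)) ≠ ⊥ := by
      intro ε h
      refine ⟨Function.update σ i ε, ?_⟩
      have e : s.inf (fun j => lit (Function.update σ i ε j) (a j)) =
          s.inf (fun j => lit (σ j) (a j)) := by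
        refine Finset.inf_congr rfl fun j hj => ?_
        rw [Function.update_of_ne]
        rintro rfl
        exact hi hj
      rw [Finset.inf_insert, e, Function.update_self, inf_left_comm, inf_comm]
      exact h
    by_cases h : y ⊓ a i = ⊥
    · refine key false fun h' => hσ ?_
      rw [← inf_top_eq y, ← sup_compl_eq_top (x := a i), inf_sup_left, h]
      simpa [lit] using h'
    · exact key true h

/-- A term takes the value `⊤` or `⊥` on each cell, as computed in the two-element algebra. -/
theorem cell_le_lit_realize (a : ι → U) (σ : ι → Bool) (t : boolLang.Term ι) :
    cell a σ ≤ lit (t.realize σ) (t.realize a) := by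
  induction t with
  | var i => exact cell_le a σ i
  | func f ts ih =>
    cases f with
    | inf =>
      have h0 := ih 0
      have h1 := ih 1
      change _ ≤ lit ((ts 0).realize σ ⊓ (ts 1).realize σ) ((ts 0).realize a ⊓ (ts 1).realize a)
      revert h0 h1
      cases (ts 0).realize σ <;> cases (ts 1).realize σ <;> simp +contextual [lit, compl_inf] <;>
        intro h h' <;> first | exact le_sup_of_le_left h | exact le_sup_of_le_right h'
    | sup =>
      have h0 := ih 0
      have h1 := ih 1
      change _ ≤ lit ((ts 0).realize σ ⊔ (ts 1).realize σ) ((ts 0).realize a ⊔ (ts 1).realize a)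
      revert h0 h1
      cases (ts 0).realize σ <;> cases (ts 1).realize σ <;> simp +contextual [lit] <;>
        intro h h' <;> first | exact le_sup_of_le_left h | exact le_sup_of_le_right h'
    | compl =>
      have h0 := ih 0
      change _ ≤ lit ((ts 0).realize σ)ᶜ ((ts 0).realize a)ᶜ
      revert h0
      cases (ts 0).realize σ <;> simp [lit]
    | bot => change _ ≤ lit ⊥ ⊥; simp [lit]
    | top => change _ ≤ lit ⊤ ⊤; simp [lit]

theorem realize_eq_bot_iff (a : ι → U) (t : boolLang.Term ι) :
    t.realize a = ⊥ ↔ ∀ σ : ι → Bool, t.realize σ = true → cell a σ = ⊥ := by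
  constructor
  · intro h σ hσ
    have := cell_le_lit_realize a σ t
    rw [hσ, h] at this
    exact eq_bot_iff.2 this
  · intro h
    by_contra hn
    obtain ⟨σ, hσ⟩ := exists_inf_cell_ne_bot a hn
    cases e : t.realize σ with
    | true => rw [h σ e, inf_bot_eq] at hσ; exact hσ rfl
    | false =>
      have := cell_le_lit_realize a σ t
      rw [e] at this
      exact hσ (eq_bot_iff.2 ((inf_le_inf_left _ this).trans_eq inf_compl_eq_bot))

/-- Two finite tuples have the same quantifier-free type: the same of their cells vanish. -/
def SamePattern {V : Type*} [BooleanAlgebra V] (a : ι → U) (b : ι → V) : Prop :=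
  ∀ σ, cell a σ = ⊥ ↔ cell b σ = ⊥

theorem SamePattern.realize_eq_bot_iff {a b : ι → U} (h : SamePattern a b)
    (t : boolLang.Term ι) : t.realize a = ⊥ ↔ t.realize b = ⊥ := by
  rw [InvEllis.realize_eq_bot_iff, InvEllis.realize_eq_bot_iff]
  exact forall_congr' fun σ => imp_congr_right fun _ => h σ

theorem SamePattern.realize_eq_iff {a b : ι → U} (h : SamePattern a b)
    (s t : boolLang.Term ι) :
    s.realize a = t.realize a ↔ s.realize b = t.realize b := by
  have := h.realize_eq_bot_iff (addTerm s t)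
  rwa [realize_addTerm, realize_addTerm, symmDiff_eq_bot, symmDiff_eq_bot] at this

theorem SamePattern.realize_le_iff {a b : ι → U} (h : SamePattern a b)
    (s t : boolLang.Term ι) :
    s.realize a ≤ t.realize a ↔ s.realize b ≤ t.realize b := by
  have := h.realize_eq_iff (Term.func (L := boolLang) (l := 2) BoolFunc.inf ![s, t]) s
  rw [← inf_eq_left, ← inf_eq_left (a := s.realize b)]
  exact this

/-- Elements below the various cells of a tuple can be glued. -/
theorem exists_glue (a : ι → U) (f : (ι → Bool) → U) (hf : ∀ σ, f σ ≤ cell a σ) :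
    ∃ c, ∀ σ, cell a σ ⊓ c = f σ ∧ cell a σ ⊓ cᶜ = cell a σ \ f σ := by
  classical
  have h : ∀ σ, cell a σ ⊓ Finset.univ.sup f = f σ := by
    intro σ
    refine le_antisymm ?_ (le_inf (hf σ) (Finset.le_sup (Finset.mem_univ σ)))
    rw [Finset.sup_inf_distrib_left]
    refine Finset.sup_le fun τ _ => ?_
    by_cases e : σ = τ
    · rw [e]; exact inf_le_right
    · exact ((inf_le_inf_left _ (hf τ)).trans_eq (cell_inf_cell a e)).trans bot_le
  refine ⟨_, fun σ => ⟨h σ, ?_⟩⟩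
  rw [← sdiff_eq, ← sdiff_inf_self_left, h]

/-- `b` splits `e`: neither `b` nor its complement is disjoint from `e`. -/
def Splits (b e : U) : Prop := e ⊓ b ≠ ⊥ ∧ e ⊓ bᶜ ≠ ⊥

theorem exists_splits_le (hU : ∀ a : U, ¬ IsAtom a) {e : U} (he : e ≠ ⊥) :
    ∃ c ≤ e, c ≠ ⊥ ∧ e \ c ≠ ⊥ := by
  have := hU e
  simp only [IsAtom, not_and, not_forall] at this
  obtain ⟨c, hc, h⟩ := this he
  exact ⟨c, hc.le, h, fun h' => hc.not_ge (sdiff_eq_bot_iff.1 h')⟩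

/-- Finitely many nonzero elements can be split simultaneously. -/
theorem exists_splits_finset (hU : ∀ a : U, ¬ IsAtom a) (s : Finset U) :
    ∃ b, ∀ e ∈ s, e ≠ ⊥ → Splits b e := by
  -- It is enough to split the nonzero cells of an enumeration of `s`: each nonzero `e ∈ s`
  -- contains one of them.
  let a : s → U := fun e => e
  have : ∀ σ, ∃ c ≤ cell a σ, cell a σ ≠ ⊥ → c ≠ ⊥ ∧ cell a σ \ c ≠ ⊥ := by
    intro σ
    by_cases h : cell a σ = ⊥
    · exact ⟨⊥, bot_le, fun h' => absurd h h'⟩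
    · obtain ⟨c, hc, h'⟩ := exists_splits_le hU h
      exact ⟨c, hc, fun _ => h'⟩
  choose f hf hf' using this
  obtain ⟨b, hb⟩ := exists_glue a f hf
  refine ⟨b, fun e he h => ?_⟩
  obtain ⟨σ, hσ⟩ := exists_inf_cell_ne_bot a h
  have hle : cell a σ ≤ e := by
    have h1 := cell_le a σ ⟨e, he⟩
    cases h2 : σ ⟨e, he⟩ with
    | true => rw [h2] at h1; exact h1
    | false =>
      rw [h2] at h1
      exact absurd (eq_bot_iff.2 ((inf_le_inf_left _ h1).trans_eq inf_compl_eq_bot)) hσ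
  have hne : cell a σ ≠ ⊥ := fun h' => hσ (by rw [h', inf_bot_eq])
  obtain ⟨h1, h2⟩ := hf' σ hne
  rw [← (hb σ).1] at h1
  rw [← (hb σ).2] at h2
  exact ⟨ne_bot_of_le_ne_bot h1 (inf_le_inf_right _ hle),
    ne_bot_of_le_ne_bot h2 (inf_le_inf_right _ hle)⟩

/-- The back-and-forth step: in an atomless algebra every one-element extension of a finite tuple
is matched by an extension of any tuple with the same pattern. -/
theorem SamePattern.exists_extend (hU : ∀ a : U, ¬ IsAtom a) {a b : ι → U}
    (h : SamePattern a b) (c : U) :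
    ∃ c', ∀ σ ε, cell a σ ⊓ lit ε c = ⊥ ↔ cell b σ ⊓ lit ε c' = ⊥ := by
  -- In the cell `σ`, the piece `x` of `c'` is chosen so that `x` and its complement in the cell
  -- vanish exactly when `c` and `cᶜ` miss the corresponding cell of `a`.
  have : ∀ σ, ∃ x ≤ cell b σ, (cell a σ ⊓ c = ⊥ ↔ x = ⊥) ∧
      (cell a σ ⊓ cᶜ = ⊥ ↔ cell b σ \ x = ⊥) := by
    intro σ
    by_cases h0 : cell b σ = ⊥
    · refine ⟨⊥, bot_le, ?_⟩
      rw [h0, (h σ).2 h0]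
      simp
    · have h0' : cell a σ ≠ ⊥ := fun h' => h0 ((h σ).1 h')
      by_cases h1 : cell a σ ⊓ c = ⊥
      · refine ⟨⊥, bot_le, by simp [h1], ?_⟩
        rw [sdiff_bot, ← h σ, ← sdiff_eq, ← sdiff_inf_self_left, h1, sdiff_bot]
      · by_cases h2 : cell a σ ⊓ cᶜ = ⊥
        · exact ⟨cell b σ, le_rfl, by simp [h1, h0], by simp [h2]⟩
        · obtain ⟨x, hx, h3, h4⟩ := exists_splits_le hU h0
          exact ⟨x, hx, by simp [h1, h3], by simp [h2, h4]⟩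
  choose f hf hf' using this
  obtain ⟨c', hc'⟩ := exists_glue b f hf
  refine ⟨c', fun σ ε => ?_⟩
  cases ε with
  | true => change _ ↔ cell b σ ⊓ c' = ⊥; rw [(hc' σ).1]; exact (hf' σ).1
  | false => change _ ↔ cell b σ ⊓ c'ᶜ = ⊥; rw [(hc' σ).2]; exact (hf' σ).2

theorem cell_snoc {n : ℕ} (v : ι → U) (xs : Fin n → U) (x : U) (σ : ι ⊕ Fin (n + 1) → Bool) :
    cell (Sum.elim v (Fin.snoc xs x : Fin (n + 1) → U)) σ =
      cell (Sum.elim v xs) (σ ∘ Sum.map id Fin.castSucc) ⊓ lit (σ (Sum.inr (Fin.last n))) x := by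
  refine eq_of_forall_le_iff fun y => ?_
  simp [le_cell_iff, Fin.forall_fin_succ', and_assoc]

theorem cell_elim_unit (d : ι → U) (b : U) (σ : ι ⊕ Unit → Bool) :
    cell (Sum.elim d (fun _ => b)) σ = cell d (σ ∘ Sum.inl) ⊓ lit (σ (Sum.inr ())) b := by
  refine eq_of_forall_le_iff fun y => ?_
  simp only [le_cell_iff, le_inf_iff, Sum.forall, Sum.elim_inl, Sum.elim_inr, Function.comp_apply,
    Unique.forall_iff, PUnit.default_eq_unit]

theorem cell_elim_fin_zero (d : ι → U) (xs : Fin 0 → U) (σ : ι ⊕ Fin 0 → Bool) :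
    cell (Sum.elim d xs) σ = cell d (σ ∘ Sum.inl) := by
  refine eq_of_forall_le_iff fun y => ?_
  simp [le_cell_iff]

/-- Elimination of quantifiers: in an atomless Boolean algebra, finite tuples with the same
pattern satisfy the same formulas. -/
theorem SamePattern.boundedFormula_realize_iff (hU : ∀ a : U, ¬ IsAtom a) {n : ℕ}
    (φ : boolLang.BoundedFormula ι n) {v v' : ι → U} {xs xs' : Fin n → U}
    (h : SamePattern (Sum.elim v xs) (Sum.elim v' xs')) :
    φ.Realize v xs ↔ φ.Realize v' xs' := by
  induction φ with
  | falsum => exact Iff.rfl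
  | equal s t => exact h.realize_eq_iff s t
  | rel R ts =>
    cases R with
    | le => exact h.realize_le_iff (ts 0) (ts 1)
  | imp φ ψ ih ih' => exact imp_congr (ih h) (ih' h)
  | all φ ih =>
    constructor
    · intro H c'
      obtain ⟨c, hc⟩ := SamePattern.exists_extend hU (fun σ => (h σ).symm) c'
      refine (ih fun σ => ?_).1 (H c)
      rw [cell_snoc, cell_snoc]
      exact (hc _ _).symm
    · intro H c
      obtain ⟨c', hc⟩ := SamePattern.exists_extend hU h c
      refine (ih fun σ => ?_).2 (H c')
      rw [cell_snoc, cell_snoc]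
      exact hc _ _

theorem SamePattern.realize_iff (hU : ∀ a : U, ¬ IsAtom a) (φ : boolLang.Formula ι)
    {v v' : ι → U} (h : SamePattern v v') : φ.Realize v ↔ φ.Realize v' := by
  refine SamePattern.boundedFormula_realize_iff hU φ fun σ => ?_
  rw [cell_elim_fin_zero, cell_elim_fin_zero]
  exact h _

theorem cell_elim_eq_bot_iff {d : ι → U} {b : U} (hb : ∀ σ, cell d σ ≠ ⊥ → Splits b (cell d σ))
    (σ : ι ⊕ Unit → Bool) :
    cell (Sum.elim d (fun _ => b)) σ = ⊥ ↔ cell d (σ ∘ Sum.inl) = ⊥ := by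
  rw [cell_elim_unit]
  refine ⟨fun h => ?_, fun h => by rw [h, bot_inf_eq]⟩
  by_contra hn
  obtain ⟨h1, h2⟩ := hb _ hn
  cases e : σ (Sum.inr ()) with
  | true => rw [e] at h; exact h1 h
  | false => rw [e] at h; exact h2 h

/-- If `d`, `d'` have the same pattern and `b`, `b'` split all their nonzero cells, then `(d, b)`
and `(d', b')` satisfy the same formulas. -/
theorem SamePattern.realize_iff_of_splits (hU : ∀ a : U, ¬ IsAtom a)
    (φ : boolLang.Formula (ι ⊕ Unit)) {d d' : ι → U} {b b' : U} (h : SamePattern d d')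
    (hb : ∀ σ, cell d σ ≠ ⊥ → Splits b (cell d σ))
    (hb' : ∀ σ, cell d' σ ≠ ⊥ → Splits b' (cell d' σ)) :
    φ.Realize (Sum.elim d (fun _ => b)) ↔ φ.Realize (Sum.elim d' (fun _ => b')) := by
  refine SamePattern.realize_iff hU φ fun σ => ?_
  rw [cell_elim_eq_bot_iff hb, cell_elim_eq_bot_iff hb']
  exact h _

theorem exists_term_realize_eq_cell (U : Type u) [BooleanAlgebra U] (σ : ι → Bool) :
    ∃ t : boolLang.Term ι, ∀ d : ι → U, t.realize d = cell d σ := by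
  classical
  suffices h : ∀ s : Finset ι, ∃ t : boolLang.Term ι,
      ∀ d : ι → U, t.realize d = s.inf (fun i => lit (σ i) (d i)) from h Finset.univ
  intro s
  induction s using Finset.induction_on with
  | empty => exact ⟨Term.func (L := boolLang) (l := 0) BoolFunc.top ![], fun d => rfl⟩
  | insert i s hi ih =>
    obtain ⟨t, ht⟩ := ih
    have : ∃ t' : boolLang.Term ι, ∀ d : ι → U, t'.realize d = lit (σ i) (d i) := by
      cases σ i with
      | true => exact ⟨Term.var i, fun d => rfl⟩
      | false =>
        exact ⟨Term.func (L := boolLang) (l := 1) BoolFunc.compl ![Term.var i], fun d => rfl⟩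
    obtain ⟨t', ht'⟩ := this
    refine ⟨Term.func (L := boolLang) (l := 2) BoolFunc.inf ![t', t], fun d => ?_⟩
    rw [Finset.inf_insert, ← ht, ← ht']
    rfl

theorem definable_cell_eq_bot (σ : ι → Bool) :
    (∅ : Set U).Definable boolLang {d : ι → U | cell d σ = ⊥} := by
  obtain ⟨t, ht⟩ := exists_term_realize_eq_cell U σ
  refine Set.empty_definable_iff.2
    ⟨t.equal (Term.func (L := boolLang) (l := 0) BoolFunc.bot ![]), ?_⟩
  ext d
  change _ ↔ Formula.Realize _ _
  rw [Formula.realize_equal, ht]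
  rfl

/-- Sets that depend only on the pattern of a tuple are definable without parameters, since there
are only finitely many patterns. -/
theorem definable_of_samePattern {D : Set (ι → U)}
    (hD : ∀ d d', SamePattern d d' → d ∈ D → d' ∈ D) : (∅ : Set U).Definable boolLang D := by
  have e : D = ⋃ S : {S : Set (ι → Bool) // ∃ d ∈ D, ∀ σ, cell d σ = ⊥ ↔ σ ∈ S},
      ⋂ σ : ι → Bool, {d : ι → U | cell d σ = ⊥ ↔ σ ∈ S.1} := by
    ext d
    simp only [Set.mem_iUnion, Set.mem_iInter]
    constructor
    · intro hd
      exact ⟨⟨{σ | cell d σ = ⊥}, d, hd, fun σ => Iff.rfl⟩, fun σ => Iff.rfl⟩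
    · rintro ⟨⟨S, d', hd', h'⟩, h⟩
      exact hD d' d (fun σ => (h' σ).trans (h σ).symm) hd'
  rw [e]
  refine Set.definable_iUnion_of_finite fun S => Set.definable_iInter_of_finite fun σ => ?_
  by_cases h : σ ∈ S.1
  · simpa only [h, iff_true] using definable_cell_eq_bot σ
  · simp only [h, iff_false]
    exact (definable_cell_eq_bot σ).compl

end Patterns

/-! ### The generic type -/

section Generic

variable {U : Type u} [BooleanAlgebra U]

/-- The formula `z ≤ x`. -/
def leFormula : boolLang.Formula (Unit ⊕ Unit) :=
  Relations.formula₂ (L := boolLang) (BoolRel.le : boolLang.Relations 2)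
    (Term.var (Sum.inl ())) (Term.var (Sum.inr ()))

/-- The formula `z ∩ x = 0`. -/
def disjFormula : boolLang.Formula (Unit ⊕ Unit) :=
  Term.equal
    (Term.func (L := boolLang) (l := 2) BoolFunc.inf
      ![Term.var (Sum.inl ()), Term.var (Sum.inr ())])
    (Term.func (L := boolLang) (l := 0) BoolFunc.bot ![])

theorem realize_leFormula {v : Unit → U} {b : U} :
    leFormula.Realize (Sum.elim v (fun _ => b)) ↔ v () ≤ b := by
  exact Formula.realize_rel₂ (L := boolLang) (R := BoolRel.le)

theorem realize_disjFormula {v : Unit → U} {b : U} :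
    disjFormula.Realize (Sum.elim v (fun _ => b)) ↔ v () ⊓ b = ⊥ := by
  rw [disjFormula, Formula.realize_equal]
  exact Iff.rfl

/-- The formula saying that `x` splits `z`. -/
def splitsFormula : boolLang.Formula (Unit ⊕ Unit) := disjFormula.not ⊓ leFormula.not

theorem realize_splitsFormula {v : Unit → U} {b : U} :
    splitsFormula.Realize (Sum.elim v (fun _ => b)) ↔ Splits b (v ()) := by
  rw [splitsFormula, Formula.realize_inf, Formula.realize_not, Formula.realize_not,
    realize_disjFormula, realize_leFormula, Splits, ← sdiff_eq, ne_eq (_ \ b), sdiff_eq_bot_iff]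

/-- A global type is generic if it says that `x` splits every nonzero element. -/
def IsGeneric (p : GlobalType boolLang U) : Prop :=
  ∀ e : U, e ≠ ⊥ → Mem p splitsFormula (fun _ => e)

theorem IsGeneric.eventually_splits {p : GlobalType boolLang U} (hp : IsGeneric p) {e : U}
    (he : e ≠ ⊥) : ∀ᶠ b in typeFilter p, Splits b e := by
  simpa only [realize_splitsFormula] using mem_iff_eventually.1 (hp e he)

theorem exists_isGeneric (hU : ∀ a : U, ¬ IsAtom a) :
    ∃ p : GlobalType boolLang U, IsGeneric p := by
  let W : Filter U := ⨅ s : Finset U, Filter.principal {b | ∀ e ∈ s, e ≠ ⊥ → Splits b e}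
  have hW : W.NeBot := by
    classical
    refine Filter.iInf_neBot_of_directed (fun s t => ⟨s ∪ t, ?_, ?_⟩) fun s =>
      Filter.principal_neBot_iff.2 (exists_splits_finset hU s)
    · exact Filter.principal_mono.2 fun b hb e he => hb e (Finset.mem_union_left _ he)
    · exact Filter.principal_mono.2 fun b hb e he => hb e (Finset.mem_union_right _ he)
  obtain ⟨p, hp⟩ := exists_globalType_of_filter (L := boolLang) W
  refine ⟨p, fun e he => hp _ _ _ ?_⟩
  have h : {b | ∀ e' ∈ ({e} : Finset U), e' ≠ ⊥ → Splits b e'} ∈ W :=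
    Filter.mem_iInf_of_mem {e} (Filter.mem_principal_self _)
  filter_upwards [h] with b hb
  exact realize_splitsFormula.2 (hb e (Finset.mem_singleton_self e) he)

/-- What a generic type says about a tuple depends only on the pattern of the tuple. -/
theorem IsGeneric.mem_iff (hU : ∀ a : U, ¬ IsAtom a) {p q : GlobalType boolLang U}
    (hp : IsGeneric p) (hq : IsGeneric q) {n : ℕ} (φ : boolLang.Formula (Fin n ⊕ Unit))
    {d d' : Fin n → U} (h : SamePattern d d') : Mem p φ d ↔ Mem q φ d' := by
  have key : ∀ (r : GlobalType boolLang U), IsGeneric r → ∀ c : Fin n → U,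
      ∀ᶠ b in typeFilter r, ∀ σ, cell c σ ≠ ⊥ → Splits b (cell c σ) := by
    intro r hr c
    refine Filter.eventually_all.2 fun σ => ?_
    by_cases hσ : cell c σ = ⊥
    · exact .of_forall fun b h' => absurd hσ h'
    · exact (hr.eventually_splits hσ).mono fun b hb _ => hb
  rw [mem_iff_eventually, mem_iff_eventually]
  constructor
  · intro H
    obtain ⟨b, hb, hb'⟩ := (H.and (key p hp d)).exists
    filter_upwards [key q hq d'] with b' h'
    exact (h.realize_iff_of_splits hU φ hb' h').1 hb
  · intro H
    obtain ⟨b, hb, hb'⟩ := (H.and (key q hq d')).exists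
    filter_upwards [key p hp d] with b' h'
    exact (h.realize_iff_of_splits hU φ h' hb').2 hb

theorem IsGeneric.eq (hU : ∀ a : U, ¬ IsAtom a) {p q : GlobalType boolLang U}
    (hp : IsGeneric p) (hq : IsGeneric q) : p = q :=
  globalType_ext fun _ φ _ => hp.mem_iff hU hq φ fun _ => Iff.rfl

theorem IsGeneric.isDefinable (hU : ∀ a : U, ¬ IsAtom a) {p : GlobalType boolLang U}
    (hp : IsGeneric p) (A : Set U) : IsDefinable A p := fun _ φ =>
  (definable_of_samePattern fun _ _ h hd => (hp.mem_iff hU hp φ h).1 hd).mono A.empty_subset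

theorem IsDefinable.isInvariant {L : FirstOrder.Language.{0, 0}} {V : Type u} [L.Structure V]
    [Nonempty V] {A : Set V} {p : GlobalType L V} (hp : IsDefinable A p) : IsInvariant A p := by
  intro n φ a b h
  obtain ⟨ψ, hψ⟩ := Set.definable_iff_exists_formula_sum.1 (hp n φ)
  have e : ∀ c : Fin n → V, Mem p φ c ↔ ψ.Realize (Sum.elim (fun a : A => (a : V)) c) :=
    fun c => Set.ext_iff.1 hψ c
  rw [e, e]
  exact h ψ

theorem mem_leftTranslate {c : U} {p : GlobalType boolLang U} {α : Type*}
    {φ : boolLang.Formula (α ⊕ Unit)} {d : α → U} :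
    Mem (leftTranslate c p) φ d ↔ Mem p (addLeft φ) (Sum.elim d (fun _ => c)) := by
  obtain ⟨n, e, χ, hχ⟩ := exists_fin_vars (U := U) φ
  rw [mem_congr fun b => hχ d _, leftTranslate, (exists_leftTranslate c p).choose_spec.1]
  refine mem_congr fun a => ?_
  rw [realize_addLeft, realize_addLeft, hχ]

theorem mem_rightTranslate {c : U} {p : GlobalType boolLang U} {α : Type*}
    {φ : boolLang.Formula (α ⊕ Unit)} {d : α → U} :
    Mem (rightTranslate p c) φ d ↔ Mem p (addRight φ) (Sum.elim d (fun _ => c)) := by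
  obtain ⟨n, e, χ, hχ⟩ := exists_fin_vars (U := U) φ
  rw [mem_congr fun b => hχ d _, rightTranslate, (exists_rightTranslate p c).choose_spec.1]
  refine mem_congr fun a => ?_
  rw [realize_addRight, realize_addRight, hχ]

theorem rightTranslate_eq_leftTranslate (p : GlobalType boolLang U) (c : U) :
    rightTranslate p c = leftTranslate c p := by
  refine globalType_ext fun n φ d => ?_
  rw [mem_rightTranslate, mem_leftTranslate]
  refine mem_congr fun a => ?_
  rw [realize_addRight, realize_addLeft, symmDiff_comm]

theorem Splits.mono {b e e' : U} (h : Splits b e') (he : e' ≤ e) : Splits b e :=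
  ⟨ne_bot_of_le_ne_bot h.1 (inf_le_inf_right _ he), ne_bot_of_le_ne_bot h.2 (inf_le_inf_right _ he)⟩

/-- Translation by `c` exchanges `x` with its complement below `c` and leaves `x` unchanged below
`cᶜ`, so it preserves splitting of elements below `c` or below `cᶜ`. -/
theorem exists_splits_symmDiff {e : U} (he : e ≠ ⊥) (c : U) :
    ∃ e' : U, e' ≠ ⊥ ∧ ∀ b, Splits b e' → Splits (symmDiff c b) e := by
  by_cases h : e ⊓ c = ⊥
  · refine ⟨e, he, fun b hb => ?_⟩
    have h1 : e ⊓ symmDiff c b = e ⊓ b := by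
      rw [inf_symmDiff_distrib_left, h, bot_symmDiff]
    refine ⟨h1 ▸ hb.1, ?_⟩
    rw [← sdiff_eq, ← sdiff_inf_self_left, h1, sdiff_inf_self_left, sdiff_eq]
    exact hb.2
  · refine ⟨e ⊓ c, h, fun b hb => Splits.mono (e' := e ⊓ c) ?_ inf_le_left⟩
    have h1 : (e ⊓ c) ⊓ symmDiff c b = (e ⊓ c) ⊓ bᶜ := by
      rw [inf_assoc, inf_symmDiff_distrib_left, inf_idem, symmDiff_of_ge inf_le_left,
        sdiff_inf_self_left, sdiff_eq, inf_assoc]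
    refine ⟨h1 ▸ hb.2, ?_⟩
    rw [← sdiff_eq, ← sdiff_inf_self_left, h1, sdiff_inf_self_left, sdiff_eq, compl_compl]
    exact hb.1

theorem IsGeneric.leftTranslate_eq (hU : ∀ a : U, ¬ IsAtom a) {p : GlobalType boolLang U}
    (hp : IsGeneric p) (c : U) : leftTranslate c p = p := by
  refine IsGeneric.eq hU (fun e he => ?_) hp
  obtain ⟨e', he', h⟩ := exists_splits_symmDiff he c
  rw [mem_leftTranslate, mem_iff_eventually]
  filter_upwards [hp.eventually_splits he'] with b hb
  rw [realize_addLeft, realize_splitsFormula]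
  exact h b hb

theorem IsGeneric.rightTranslate_eq (hU : ∀ a : U, ¬ IsAtom a) {p : GlobalType boolLang U}
    (hp : IsGeneric p) (c : U) : rightTranslate p c = p := by
  rw [rightTranslate_eq_leftTranslate, hp.leftTranslate_eq hU]

end Generic

/-! ### The generic type is a zero of the semigroup of invariant types -/

section Zero

variable {U : Type u} [BooleanAlgebra U] {M : boolLang.ElementarySubstructure U}

theorem top_mem (M : boolLang.ElementarySubstructure U) : (⊤ : U) ∈ M :=
  M.toSubstructure.fun_mem (n := 0) BoolFunc.top ![] (fun i => i.elim0)

/-- Since the generic type is invariant under complementation, so are its realizations. -/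
theorem IsGeneric.realizes_compl (hU : ∀ a : U, ¬ IsAtom a) {p : GlobalType boolLang U}
    (hp : IsGeneric p) {A : Set U} (hA : ⊤ ∈ A) {b : U} (hb : Realizes p A b) :
    Realizes p A bᶜ := by
  intro φ hφ
  rw [← hp.rightTranslate_eq hU ⊤, mem_rightTranslate, ← hb.realize_iff, realize_addRight,
    symmDiff_top] at hφ
  · exact hφ
  · rintro (i | i)
    · exact i.2
    · exact hA

variable [IsSmall M]

theorem IsGeneric.newelski_left (hU : ∀ a : U, ¬ IsAtom a) {p : SInv M}
    (hp : IsGeneric p.val) (q : GlobalType boolLang U) : newelski M p q = p.val := by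
  refine globalType_ext fun n φ d => ?_
  obtain ⟨b, hb⟩ := exists_realizes M q (Set.finite_range d)
  rw [mem_newelski hb, ← mem_rightTranslate, hp.rightTranslate_eq hU]

/-- If `b` is generic over `M` and `e`, then so is `bᶜ`. Hence if an invariant type `q` said that
`x + b` contains `e ≠ 0`, or that it is disjoint from `e`, it would say the same of its complement
`x + bᶜ`, which is absurd. -/
theorem IsGeneric.newelski_right (hU : ∀ a : U, ¬ IsAtom a) {p : GlobalType boolLang U}
    (hp : IsGeneric p) (q : SInv M) : newelski M q p = p := by
  refine IsGeneric.eq hU (fun e he => ?_) hp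
  obtain ⟨b, hb⟩ := exists_realizes M p (Set.finite_range fun _ : Unit => e)
  have hb' := hp.realizes_compl hU (Or.inl (top_mem M)) hb
  -- The element `a` found here is a value of `x + b`.
  have key : ∀ φ : boolLang.Formula (Unit ⊕ Unit), Mem (newelski M q p) φ (fun _ => e) →
      ∃ a : U, φ.Realize (Sum.elim (fun _ => e) (fun _ => a)) ∧
        φ.Realize (Sum.elim (fun _ => e) (fun _ => aᶜ)) := by
    intro φ hφ
    have h1 := mem_iff_eventually.1 ((mem_newelski hb).1 hφ)
    have h2 := mem_iff_eventually.1 ((mem_newelski hb').1 hφ)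
    obtain ⟨a, ha, ha'⟩ := (h1.and h2).exists
    rw [realize_addRight] at ha ha'
    refine ⟨_, ha, ?_⟩
    rwa [← hnot_eq_compl, ← symmDiff_top, symmDiff_assoc, symmDiff_top, hnot_eq_compl]
  rw [splitsFormula, mem_inf, mem_not, mem_not]
  constructor
  · intro h
    obtain ⟨a, ha, ha'⟩ := key _ h
    rw [realize_disjFormula] at ha ha'
    apply he
    rw [← inf_top_eq e, ← sup_compl_eq_top (x := a), inf_sup_left, ha, ha', sup_bot_eq]
  · intro h
    obtain ⟨a, ha, ha'⟩ := key _ h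
    rw [realize_leFormula] at ha ha'
    exact he (eq_bot_iff.2 ((le_inf ha ha').trans_eq inf_compl_eq_bot))

end Zero

/-! ### The independence property -/

section Independence

variable {U : Type u} [BooleanAlgebra U]

theorem exists_pairwise_disjoint (hU : ∀ a : U, ¬ IsAtom a) (k : ℕ) {e : U} (he : e ≠ ⊥) :
    ∃ a : Fin k → U, (∀ i, a i ≠ ⊥) ∧ (∀ i, a i ≤ e) ∧ ∀ i j, i ≠ j → Disjoint (a i) (a j) := by
  induction k generalizing e with
  | zero => exact ⟨Fin.elim0, fun i => i.elim0, fun i => i.elim0, fun i => i.elim0⟩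
  | succ k ih =>
    obtain ⟨c, hc, h1, h2⟩ := exists_splits_le hU he
    obtain ⟨a, ha, hae, had⟩ := ih h2
    refine ⟨Fin.cons c a, ?_, ?_, ?_⟩
    · intro i; cases i using Fin.cases <;> simp [h1, ha]
    · intro i; cases i using Fin.cases <;> simp [hc, (hae _).trans sdiff_le]
    · intro i j
      have h : ∀ i, Disjoint c (a i) := fun i => disjoint_sdiff_self_right.mono_right (hae i)
      cases i using Fin.cases <;> cases j using Fin.cases
      · simp
      · simp [h]
      · simp [(h _).symm]
      · intro hij
        simpa using had _ _ fun h' => hij (by rw [h'])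

/-- The formula `y ≤ z` has the independence property, as witnessed by disjoint elements and their
unions. -/
theorem hasIP [Nontrivial U] (hU : ∀ a : U, ¬ IsAtom a) : HasIP boolLang U := by
  classical
  refine ⟨1, 1, Relations.formula₂ (L := boolLang) (BoolRel.le : boolLang.Relations 2)
    (Term.var (Sum.inl 0)) (Term.var (Sum.inr 0)), fun k => ?_⟩
  obtain ⟨a, ha, -, had⟩ := exists_pairwise_disjoint hU k (top_ne_bot (α := U))
  refine ⟨fun i _ => a i, fun S _ => (Finset.univ.filter (· ∈ S)).sup a, fun i S => ?_⟩
  refine (Formula.realize_rel₂ (L := boolLang) (R := BoolRel.le)).trans ?_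
  change a i ≤ (Finset.univ.filter (· ∈ S)).sup a ↔ _
  constructor
  · intro h
    by_contra hi
    refine ha i (disjoint_self.1 (Disjoint.mono_right h ?_))
    refine Finset.disjoint_sup_right.2 fun j hj => had i j ?_
    rintro rfl
    exact hi (Finset.mem_filter.1 hj).2
  · intro h
    exact Finset.le_sup (Finset.mem_filter.2 ⟨Finset.mem_univ i, h⟩)

end Independence

/-! ### Ellis subgroups of semigroups -/

section Ellis

variable {X : Type*} [Semigroup X]

/-- In a semigroup with a zero, the zero is the only minimal left ideal. -/
theorem isEllisSubgroup_iff_of_zero {z : X} (hl : ∀ x, z * x = z) (hr : ∀ x, x * z = z)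
    (E : Subsemigroup X) : IsEllisSubgroup E ↔ (E : Set X) = {z} := by
  have hz : IsLeftIdeal ({z} : Set X) := by
    refine ⟨Set.singleton_nonempty z, ?_⟩
    rintro x _ rfl
    exact hr x
  have hmem : ∀ I : Set X, IsLeftIdeal I → z ∈ I := by
    rintro I ⟨⟨y, hy⟩, h⟩
    rw [← hl y]
    exact h z y hy
  constructor
  · rintro ⟨I, u, hI, hu, -, hE⟩
    obtain rfl := hI.2 {z} hz (Set.singleton_subset_iff.2 (hmem I hI.1))
    obtain rfl : u = z := hu
    rw [hE]
    ext y
    simp [hl]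
  · intro hE
    refine ⟨{z}, z, ⟨hz, fun J hJ h => h.antisymm (Set.singleton_subset_iff.2 (hmem J hJ))⟩,
      rfl, hl z, ?_⟩
    rw [hE]
    ext y
    simp [hl]

/-- A compact Hausdorff semigroup whose right multiplications are continuous has an Ellis
subgroup: Zorn's lemma gives a minimal closed left ideal, which is a minimal left ideal because
the left ideals `X y` are closed, and the Ellis–Numakura lemma gives an idempotent in it. -/
theorem exists_isEllisSubgroup [TopologicalSpace X] [CompactSpace X] [T2Space X] [Nonempty X]
    (hc : ∀ y : X, Continuous (· * y)) : ∃ E : Subsemigroup X, IsEllisSubgroup E := by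
  obtain ⟨I, hI⟩ : ∃ I, Minimal (· ∈ {I : Set X | IsClosed I ∧ IsLeftIdeal I}) I := by
    refine zorn_superset _ fun c hcs hchain => ?_
    refine ⟨⋂₀ c, ⟨isClosed_sInter fun t ht => (hcs ht).1, ?_, fun x y hy t ht =>
      (hcs ht).2.2 x y (hy t ht)⟩, fun s hs => Set.sInter_subset_of_mem hs⟩
    rcases c.eq_empty_or_nonempty with rfl | hne
    · rw [Set.sInter_empty]
      exact Set.univ_nonempty
    · have := hne.to_subtype
      rw [Set.sInter_eq_iInter]
      exact IsCompact.nonempty_iInter_of_directed_nonempty_isCompact_isClosed _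
        (DirectedOn.directed_val (IsChain.directedOn hchain.symm)) (fun i => (hcs i.2).2.1)
        (fun i => (hcs i.2).1.isCompact) (fun i => (hcs i.2).1)
  obtain ⟨hIc, hIl⟩ := hI.prop
  have hmin : IsMinimalLeftIdeal I := by
    refine ⟨hIl, fun J hJ hJI => hJI.antisymm ?_⟩
    obtain ⟨y, hy⟩ := hJ.1
    have h : Set.range (· * y) ⊆ J := by
      rintro _ ⟨x, rfl⟩
      exact hJ.2 x y hy
    refine (hI.le_of_le ⟨(isCompact_range (hc y)).isClosed, Set.range_nonempty _, ?_⟩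
      (h.trans hJI)).trans h
    rintro x _ ⟨x', rfl⟩
    exact ⟨x * x', mul_assoc _ _ _⟩
  obtain ⟨u, hu, huu⟩ := exists_idempotent_in_compact_subsemigroup hc I hIl.1 hIc.isCompact
    fun x _ y hy => hIl.2 x y hy
  refine ⟨⟨{y | ∃ x ∈ I, y = u * x}, ?_⟩, I, u, hmin, hu, huu, rfl⟩
  rintro _ _ ⟨x, hx, rfl⟩ ⟨y, hy, rfl⟩
  exact ⟨x * (u * y), hIl.2 _ _ (hIl.2 _ _ hy), mul_assoc _ _ _⟩

/-- Ellis subgroups of a semigroup that maps onto a nontrivial group are nontrivial: the idempotent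
`u` goes to `1`, so `u * (x * u)` has the same image as `x`. -/
theorem IsEllisSubgroup.nontrivial {G : Type*} [Group G] [Nontrivial G] (f : X →ₙ* G)
    (hf : Function.Surjective f) {E : Subsemigroup X} (hE : IsEllisSubgroup E) :
    (E : Set X).Nontrivial := by
  obtain ⟨I, u, hI, hu, huu, hE⟩ := hE
  have h1 : f u = 1 := by
    have := congrArg f huu
    rwa [map_mul, mul_eq_left] at this
  obtain ⟨g, hg⟩ := exists_ne (1 : G)
  obtain ⟨x, rfl⟩ := hf g
  rw [hE]
  refine ⟨u, ⟨u, hu, huu.symm⟩, u * (x * u), ⟨x * u, hI.1.2 x u hu, rfl⟩, fun h => hg ?_⟩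
  have := congrArg f h
  rw [map_mul, map_mul, h1, one_mul, mul_one] at this
  exact this.symm

end Ellis

/-! ### The semigroup of finitely satisfiable types -/

section FinSat

variable {U : Type u} [BooleanAlgebra U] {M : boolLang.ElementarySubstructure U}

instance : TopologicalSpace (SFs M) := TopologicalSpace.induced SFs.val inferInstance

theorem isClopen_mem {L : FirstOrder.Language.{0, 0}} {V : Type u} [L.Structure V] [Nonempty V]
    {α : Type*} (φ : L.Formula (α ⊕ Unit)) (d : α → V) :
    IsClopen {p : GlobalType L V | Mem p φ d} :=
  CompleteType.isClopen_typesWith _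

theorem SFs.isEmbedding_val : Topology.IsEmbedding (SFs.val : SFs M → GlobalType boolLang U) :=
  ⟨⟨rfl⟩, fun _ _ h => SFs.ext h⟩

theorem SFs.isClosedEmbedding_val :
    Topology.IsClosedEmbedding (SFs.val : SFs M → GlobalType boolLang U) := by
  refine ⟨SFs.isEmbedding_val, ?_⟩
  have e : Set.range (SFs.val : SFs M → GlobalType boolLang U) =
      {p | IsFinSat (M : Set U) p} := by
    ext p
    exact ⟨fun ⟨q, hq⟩ => hq ▸ q.2, fun hp => ⟨⟨p, hp⟩, rfl⟩⟩
  rw [e]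
  simp only [IsFinSat, Set.ofPred_forall]
  refine isClosed_iInter fun n => isClosed_iInter fun φ => isClosed_iInter fun d => ?_
  exact isClosed_imp (isClopen_mem φ d).2 isClosed_const

instance : CompactSpace (SFs M) := SFs.isClosedEmbedding_val.compactSpace

instance : T2Space (SFs M) := SFs.isEmbedding_val.t2Space

/-- The type over `U` of an element of `M` is finitely satisfiable in `M`. -/
theorem exists_sFs_realized {a : U} (ha : a ∈ M) :
    ∃ p : SFs M, ∀ (α : Type) (φ : boolLang.Formula (α ⊕ Unit)) (d : α → U),
      Mem p.val φ d ↔ φ.Realize (Sum.elim d (fun _ => a)) := by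
  obtain ⟨p, hp⟩ := exists_globalType_of_filter (L := boolLang) (pure a : Filter U)
  have h : ∀ (α : Type) (φ : boolLang.Formula (α ⊕ Unit)) (d : α → U),
      Mem p φ d ↔ φ.Realize (Sum.elim d (fun _ => a)) := by
    refine fun α φ d => ⟨fun h => ?_, fun h => hp α φ d h⟩
    by_contra hn
    exact mem_not.1 (hp α φ.not d (Formula.realize_not.2 hn)) h
  exact ⟨⟨p, fun n φ d hφ => ⟨a, ha, (h _ φ d).1 hφ⟩⟩, h⟩

theorem SFs.mem_disj_of_not_mem_le {d : U} (hd : ∀ m ∈ M, d ⊓ m = ⊥ ∨ d ≤ m)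
    {p : SFs M} (h : ¬ Mem p.val leFormula (fun _ => d)) : Mem p.val disjFormula (fun _ => d) := by
  by_contra hn
  obtain ⟨m, hm, h'⟩ := p.property.exists_mem (mem_inf.2 ⟨mem_not.2 h, mem_not.2 hn⟩)
  rw [Formula.realize_inf, Formula.realize_not, Formula.realize_not, realize_leFormula,
    realize_disjFormula] at h'
  exact (hd m hm).elim h'.2 h'.1

variable [IsSmall M]

theorem SFs.val_mul (p q : SFs M) : (p * q).val = newelski M p.toSInv q.val := rfl

theorem SFs.continuous_mul_right (q : SFs M) : Continuous (· * q : SFs M → SFs M) := by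
  refine SFs.isEmbedding_val.continuous_iff.2 (continuous_generateFrom_iff.2 ?_)
  rintro _ ⟨σ, rfl⟩
  obtain ⟨n, φ, d, h⟩ := exists_mem_iff (L := boolLang) (U := U) σ
  obtain ⟨b, hb⟩ := exists_realizes M q.val (Set.finite_range d)
  have e : (SFs.val ∘ fun p : SFs M => p * q) ⁻¹'
      ((boolLang[[U]].completeTheory U).typesWith σ) =
      SFs.val ⁻¹' {p | Mem p (addRight φ) (Sum.elim d (fun _ => b))} := by
    ext p
    change σ ∈ (p * q).val ↔ Mem p.val _ _
    rw [h, SFs.val_mul, mem_newelski hb]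
    rfl
  rw [e]
  exact (isClopen_mem _ _).2.preimage SFs.isEmbedding_val.continuous

/-- By saturation, there is a nonzero element of `U` below all members of some ultrafilter of `M`;
no element of `M` splits it. -/
theorem exists_ne_bot_not_splits [Nontrivial U] (M : boolLang.ElementarySubstructure U)
    [IsSmall M] : ∃ d : U, d ≠ ⊥ ∧ ∀ m ∈ M, d ⊓ m = ⊥ ∨ d ≤ m := by
  obtain ⟨P, hP, -, -⟩ := DistribLattice.prime_ideal_of_disjoint_filter_ideal
    (α := U) (F := Order.PFilter.principal ⊤) (I := Order.Ideal.principal ⊥)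
    (Set.disjoint_left.2 fun x hx hx' => top_ne_bot (α := U) (le_bot_iff.1
      ((Order.PFilter.mem_principal.1 hx).trans (Order.Ideal.mem_principal.1 hx'))))
  -- The complement of the prime ideal `P` is an ultrafilter of `U`; `d` will realize over `M` a
  -- type saying that `x` is nonzero and below each of its members.
  let W : Filter U := ⨅ m : {m : U // m ∉ P}, Filter.principal {b | b ≠ ⊥ ∧ b ≤ m.1}
  have hW : W.NeBot := by
    have : Nonempty {m : U // m ∉ P} := ⟨⊤, hP.toIsProper.top_notMem⟩
    refine Filter.iInf_neBot_of_directed (fun m m' => ⟨⟨m.1 ⊓ m'.1, fun h =>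
      (hP.mem_or_mem h).elim m.2 m'.2⟩, ?_, ?_⟩) fun m => Filter.principal_neBot_iff.2
        ⟨m.1, fun h => m.2 (h ▸ P.bot_mem), le_rfl⟩
    · exact Filter.principal_mono.2 fun b hb => ⟨hb.1, hb.2.trans inf_le_left⟩
    · exact Filter.principal_mono.2 fun b hb => ⟨hb.1, hb.2.trans inf_le_right⟩
  obtain ⟨q, hq⟩ := exists_globalType_of_filter (L := boolLang) W
  obtain ⟨d, hd⟩ := exists_realizes M q Set.finite_empty
  have hmem : ∀ m : U, m ∉ P → ∀ᶠ b in W, b ≠ ⊥ ∧ b ≤ m := fun m hm =>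
    Filter.mem_iInf_of_mem (⟨m, hm⟩ : {m : U // m ∉ P}) (Filter.mem_principal_self _)
  have htop : (⊤ : U) ∉ P := hP.toIsProper.top_notMem
  have key : ∀ (m : U) (φ : boolLang.Formula (Unit ⊕ Unit)), m ∈ M →
      (∀ᶠ b in W, φ.Realize (Sum.elim (fun _ => m) (fun _ => b))) →
      φ.Realize (Sum.elim (fun _ => m) (fun _ => d)) := fun m φ hm h =>
    (hd.realize_iff φ fun _ => Or.inl hm).2 (hq _ _ _ h)
  have hdisj : ∀ m ∈ M, m ∈ P → m ⊓ d = ⊥ := by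
    intro m hm hmP
    rw [← realize_disjFormula (v := fun _ => m)]
    have hc : mᶜ ∉ P := fun h => htop (by
      rw [← sup_compl_eq_top (x := m)]; exact P.sup_mem hmP h)
    refine key m _ hm ((hmem _ hc).mono fun b hb => realize_disjFormula.2 ?_)
    rw [inf_comm, ← disjoint_iff]
    exact le_compl_iff_disjoint_right.1 hb.2
  refine ⟨d, ?_, fun m hm => ?_⟩
  -- The formula `z ∩ x ≠ 0` with `z = 1` expresses that `x` is nonzero.
  · have := key ⊤ disjFormula.not (top_mem M) ((hmem _ htop).mono fun b hb => by
      rw [Formula.realize_not, realize_disjFormula, top_inf_eq]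
      exact hb.1)
    rwa [Formula.realize_not, realize_disjFormula, top_inf_eq] at this
  · by_cases hmP : m ∈ P
    · exact Or.inl (by rw [inf_comm]; exact hdisj m hm hmP)
    · have hmc : mᶜ ∈ M := M.toSubstructure.fun_mem (n := 1) BoolFunc.compl ![m]
        (fun i => by fin_cases i; exact hm)
      have := hdisj mᶜ hmc (hP.compl_mem_of_notMem hmP)
      rw [inf_comm, ← sdiff_eq, sdiff_eq_bot_iff] at this
      exact Or.inr this

section Character

variable {d : U}

/-- If no element of `M` splits `d ≠ 0`, then `d ≤ x` or `d ∩ x = 0` is in each type finitely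
satisfiable in `M`, and which of the two adds modulo `2`. -/
theorem SFs.mem_mul_iff (hd0 : d ≠ ⊥) (hd : ∀ m ∈ M, d ⊓ m = ⊥ ∨ d ≤ m) (p q : SFs M) :
    Mem (p * q).val leFormula (fun _ => d) ↔
      ¬ (Mem p.val leFormula (fun _ => d) ↔ Mem q.val leFormula (fun _ => d)) := by
  obtain ⟨b, hb⟩ := exists_realizes M q.val (Set.finite_range fun _ : Unit => d)
  have hr : ∀ φ : boolLang.Formula (Unit ⊕ Unit), φ.Realize (Sum.elim (fun _ => d) (fun _ => b)) ↔
      Mem q.val φ (fun _ => d) := fun φ => hb.realize_iff φ fun _ => Or.inr ⟨(), rfl⟩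
  rw [SFs.val_mul, mem_newelski hb, mem_iff_eventually]
  change (∀ᶠ a in typeFilter p.val, _) ↔ _
  simp only [realize_addRight, realize_leFormula]
  have key : ∀ {P : U → Prop} {Q : Prop}, (∀ᶠ a in typeFilter p.val, P a ↔ Q) →
      ((∀ᶠ a in typeFilter p.val, P a) ↔ Q) := fun h =>
    (Filter.eventually_congr h).trans Filter.eventually_const
  have hle : ∀ c : U, d ≤ c → d ⊓ c = d := fun c => inf_eq_left.2
  have hb' : (d ⊓ b = d ∧ Mem q.val leFormula (fun _ => d)) ∨
      (d ⊓ b = ⊥ ∧ ¬ Mem q.val leFormula (fun _ => d)) := by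
    by_cases h : Mem q.val leFormula (fun _ => d)
    · exact Or.inl ⟨hle _ (realize_leFormula.1 ((hr _).2 h)), h⟩
    · exact Or.inr ⟨realize_disjFormula.1 ((hr _).2 (SFs.mem_disj_of_not_mem_le hd h)), h⟩
  refine key ?_
  by_cases h : Mem p.val leFormula (fun _ => d)
  · filter_upwards [mem_iff_eventually.1 h] with a ha
    rw [realize_leFormula] at ha
    rw [← inf_eq_left, inf_symmDiff_distrib_left, hle _ ha]
    rcases hb' with ⟨h1, h2⟩ | ⟨h1, h2⟩ <;> simp [h1, h, h2, hd0.symm]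
  · filter_upwards [mem_iff_eventually.1 (SFs.mem_disj_of_not_mem_le hd h)] with a ha
    rw [realize_disjFormula] at ha
    rw [← inf_eq_left, inf_symmDiff_distrib_left, ha]
    rcases hb' with ⟨h1, h2⟩ | ⟨h1, h2⟩ <;> simp [h1, h, h2, hd0.symm]

open scoped Classical in
/-- The homomorphism from the semigroup of finitely satisfiable types to `ℤ/2` that tells whether
`d ≤ x` belongs to a type, for an element `d ≠ 0` that no element of `M` splits. -/
noncomputable def SFs.character (hd0 : d ≠ ⊥) (hd : ∀ m ∈ M, d ⊓ m = ⊥ ∨ d ≤ m) :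
    SFs M →ₙ* Multiplicative (ZMod 2) where
  toFun p := Multiplicative.ofAdd (if Mem p.val leFormula (fun _ => d) then 1 else 0)
  map_mul' p q := by
    rw [← ofAdd_add]
    congr 1
    simp only [SFs.mem_mul_iff hd0 hd]
    by_cases h : Mem p.val leFormula (fun _ => d) <;>
      by_cases h' : Mem q.val leFormula (fun _ => d) <;> simp [h, h']
    decide

theorem SFs.character_surjective (hd0 : d ≠ ⊥) (hd : ∀ m ∈ M, d ⊓ m = ⊥ ∨ d ≤ m) :
    Function.Surjective (SFs.character hd0 hd) := by
  classical
  obtain ⟨p, hp⟩ := exists_sFs_realized (top_mem M)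
  obtain ⟨q, hq⟩ := exists_sFs_realized (M := M) (a := ⊥)
    (M.toSubstructure.fun_mem (n := 0) BoolFunc.bot ![] (fun i => i.elim0))
  have h1 : SFs.character hd0 hd p = Multiplicative.ofAdd 1 :=
    congrArg Multiplicative.ofAdd (if_pos ((hp _ _ _).2 (realize_leFormula.2 le_top)))
  have h0 : SFs.character hd0 hd q = Multiplicative.ofAdd 0 :=
    congrArg Multiplicative.ofAdd (if_neg fun h =>
      hd0 (le_bot_iff.1 (realize_leFormula.1 ((hq _ _ _).1 h))))
  intro g
  obtain ⟨x, rfl⟩ := Multiplicative.ofAdd.surjective g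
  fin_cases x
  · exact ⟨q, h0⟩
  · exact ⟨p, h1⟩

end Character

end FinSat
end InvEllis

theorem mainTheorem9 {U : Type u} [BooleanAlgebra U] [Nontrivial U]
    (hU : ∀ a : U, ¬ IsAtom a)
    (M : InvEllis.boolLang.ElementarySubstructure U) [InvEllis.IsSmall M] :
    -- symmetric difference makes the algebra an abelian group
    (∃ G : AddCommGroup U, ∀ a b : U, G.add a b = symmDiff a b) ∧
    -- the theory has the independence property
    InvEllis.HasIP InvEllis.boolLang U ∧
    -- the group is dfg, witnessed by a type definable without parameters
    (∃ p : InvEllis.SInv M, InvEllis.IsDefinable ∅ p.val ∧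
      InvEllis.IsLeftDfg (M : Set U) p.val ∧ InvEllis.IsRightDfg (M : Set U) p.val) ∧
    -- Ellis subgroups exist in both semigroups
    (∃ E : Subsemigroup (InvEllis.SInv M), InvEllis.IsEllisSubgroup E) ∧
    (∃ E : Subsemigroup (InvEllis.SFs M), InvEllis.IsEllisSubgroup E) ∧
    -- those of invariant types are trivial
    (∀ E : Subsemigroup (InvEllis.SInv M), InvEllis.IsEllisSubgroup E →
      ∃ p, (E : Set (InvEllis.SInv M)) = {p}) ∧
    -- those of finitely satisfiable types are nontrivial
    (∀ E : Subsemigroup (InvEllis.SFs M), InvEllis.IsEllisSubgroup E →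
      (E : Set (InvEllis.SFs M)).Nontrivial) ∧
    -- hence the two are never isomorphic
    (∀ (E : Subsemigroup (InvEllis.SInv M)) (E' : Subsemigroup (InvEllis.SFs M)),
      InvEllis.IsEllisSubgroup E → InvEllis.IsEllisSubgroup E' → IsEmpty (E ≃* E')) := by
  obtain ⟨p, hp⟩ := InvEllis.exists_isGeneric hU
  let z : InvEllis.SInv M := ⟨p, (hp.isDefinable hU M).isInvariant⟩
  have hl : ∀ q : InvEllis.SInv M, z * q = z := fun q =>
    InvEllis.SInv.ext (InvEllis.IsGeneric.newelski_left hU (p := z) hp q.val)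
  have hr : ∀ q : InvEllis.SInv M, q * z = z := fun q =>
    InvEllis.SInv.ext (hp.newelski_right hU q)
  have hInv := InvEllis.isEllisSubgroup_iff_of_zero hl hr
  have hFs : ∀ E : Subsemigroup (InvEllis.SFs M), InvEllis.IsEllisSubgroup E →
      (E : Set (InvEllis.SFs M)).Nontrivial := by
    obtain ⟨d, hd0, hd⟩ := InvEllis.exists_ne_bot_not_splits M
    exact fun E hE => hE.nontrivial _ (InvEllis.SFs.character_surjective hd0 hd)
  -- The group of a Boolean ring is that of symmetric difference.
  refine ⟨⟨inferInstanceAs (AddCommGroup (AsBoolRing U)), fun a b => rfl⟩, InvEllis.hasIP hU,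
    ⟨z, hp.isDefinable hU ∅, ⟨hp.isDefinable hU M, fun c => ?_⟩, hp.isDefinable hU M, fun c => ?_⟩,
    ?_, ?_, fun E hE => ⟨z, (hInv E).1 hE⟩, hFs, fun E E' hE hE' => ⟨fun f => ?_⟩⟩
  · exact (hp.leftTranslate_eq hU c).symm ▸ hp.isDefinable hU M
  · exact (hp.rightTranslate_eq hU c).symm ▸ hp.isDefinable hU M
  · refine ⟨⟨{z}, ?_⟩, (hInv _).2 rfl⟩
    rintro _ _ rfl rfl
    exact hl z
  · have : Nonempty (InvEllis.SFs M) :=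
      ⟨(InvEllis.exists_sFs_realized (InvEllis.top_mem M)).choose⟩
    exact InvEllis.exists_isEllisSubgroup InvEllis.SFs.continuous_mul_right
  · have hE1 := (hInv E).1 hE
    obtain ⟨x, hx, y, hy, hxy⟩ := hFs E' hE'
    have h : ∀ e : E, e.1 = z := fun e => by
      have : e.1 ∈ (E : Set (InvEllis.SInv M)) := e.2
      rwa [hE1] at this
    have : f.symm ⟨x, hx⟩ = f.symm ⟨y, hy⟩ := Subtype.ext ((h _).trans (h _).symm)
    exact hxy (congrArg Subtype.val (f.symm.injective this))
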